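/- Conventions. Graphs are simplicial (no loops or multiple edges), with edges of length $1$ and the path metric $d$; a graph is $\delta$-hyperbolic if it is connected and its geodesic triangles are $\delta$-slim. Induced subgraphs of a graph $X$ are identified with their vertex sets; for an induced subgraph $F$, $lk(F)$ is the set of vertices of $X$ adjacent to all vertices of $F$. Let $X$ be a simplicial graph. A graph factor system of complexity $n$ on $X$ is a collection $\mathfrak F$ of non-empty induced subgraphs of $X$ (called domains) such that $X\in\mathfrak F$; $lk(v)\in\mathfrak F$ for every vertex $v$ with $lk(v)\neq\emptyset$; $F_1\cap F_2\in\mathfrak F$ for all $F_1,F_2\in\mathfrak F$ with $F_1\cap F_2\ne\emptyset$; and every chain $F_1\subsetneq\dots\subsetneq F_k$ in $\mathfrak F$ has $k<n$. For an induced subgraph $F$ of $X$, an $F$-graph is a graph whose vertices are the maximal cliques of $F$. Let $W$ be an $X$-graph. For each domain $F\neq X$ take a new vertex $b_F$. The augmented graph $CX$ has vertex set $V(X)\cup\{b_F : F\in\mathfrak F,\ F\ne X\}$; two distinct vertices $v,w$ of $X$ are adjacent in it if they are adjacent in $X$ or lie in two $W$-adjacent maximal cliques ($v$ in one, $w$ in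 the other), $b_F$ is adjacent to exactly the vertices of $F$. For a domain $F$, $CF$ is the subgraph of $CX$ induced on $V(F)\cup\{b_H: H\in\mathfrak F,\ H\subsetneq F\}$; the projection part of $F$ is $$PF=lk(F)\cup\{b_H: H\in\mathfrak F,\ H\subseteq lk(F)\}\cup\{b_H : H\in\mathfrak F,\ F\subseteq H\neq X\},$$ and $Y_F$ is the subgraph of $CX$ induced on the complement of $PF$ (it contains $CF$). The triple $(X,W,\mathfrak F)$ is an $(n,\delta)$-CHHF, where $\delta>0$, if $\mathfrak F$ is a graph factor system of complexity $n$ and the following hold. 1. (Hyperbolicity) For every domain $F$, $CF$ is $\delta$-hyperbolic and the inclusion $CF\to Y_F$ is a $(\delta,\delta)$-quasi-isometric embedding. 2. (Hierarchy) There are $F$-graphs $W^F$, one for each domain $F$, such that for all domains $F'\subseteq F$: (a) the augmented graph of $F'$ computed in the triple $(F,W^F,\{H\in\mathfrak F: H\subseteq F\})$ equals $CF'$; (b) for every (possibly empty) maximal clique $x$ of $lk(F')\cap F$ there is a map from the vertices of $W^{F'}$ to those of $W^F$ that sends adjacent vertices to equal or adjacent ones and sends each maximal clique $w$ of $F'$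 to a maximal clique of $F$ containing $x\cup w$. For a domain $F$ and a vertex $x$ of $Y_F$ let $p_F(x)=\{a\in CF : d_{Y_F}(x,a)\le d_{Y_F}(x,CF)+1\}$ be its coarse closest-point projection. **Lemma 3.22.** For all $n\in\mathbb N$ and $\delta>0$ there is a constant $C=C(n,\delta)$ such that, for every $(n,\delta)$-CHHF $(X,W,\mathfrak F)$, every domain $F\in\mathfrak F$ with $F\neq X$ and all vertices $x,y$ of $Y_F$: if $d_{CF}(a,b)\ge C$ for some $a\in p_F(x)$, $b\in p_F(y)$ (in particular, if $d_{CF}(p_F(x),p_F(y))\ge C$), then every geodesic of $CX$ from $x$ to $y$ contains a vertex of $PF$. -/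

import Mathlib

namespace CHHF

/-! ### Coarse geometry of graphs (edges have length one, `SimpleGraph.dist` is the path metric) -/

/-- A walk that is a geodesic between its endpoints. -/
def IsGeodesic {A : Type*} {H : SimpleGraph A} {a b : A} (p : H.Walk a b) : Prop :=
  p.length = H.dist a b

/-- A `δ`-hyperbolic graph: it is connected and its geodesic triangles are `δ`-slim. -/
def IsHyperbolic {A : Type*} (H : SimpleGraph A) (δ : ℝ) : Prop :=
  H.Connected ∧
    ∀ (a b c : A) (p : H.Walk a b) (q : H.Walk b c) (r : H.Walk a c),
      IsGeodesic p → IsGeodesic q → IsGeodesic r →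
        ∀ u ∈ p.support, ∃ v, (v ∈ q.support ∨ v ∈ r.support) ∧ (H.dist u v : ℝ) ≤ δ

/-- A `(K, K)`-quasi-isometric embedding from a connected graph `H` to a graph `H'`
(the image has to lie in one component of `H'`, so that all distances are finite). -/
def IsQIEmbedding {A B : Type*} (H : SimpleGraph A) (H' : SimpleGraph B) (K : ℝ) (f : A → B) :
    Prop :=
  ∀ a b : A, H'.Reachable (f a) (f b) ∧
    (H.dist a b : ℝ) / K - K ≤ (H'.dist (f a) (f b) : ℝ) ∧
    (H'.dist (f a) (f b) : ℝ) ≤ K * (H.dist a b : ℝ) + K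

/-! ### Links, maximal cliques, factor systems

Induced subgraphs of the graph `G` are given by their vertex sets. -/

/-- The link of an induced subgraph: the vertices adjacent to all its vertices. -/
def link {V : Type*} (G : SimpleGraph V) (S : Set V) : Set V :=
  {v | ∀ u ∈ S, G.Adj u v}

/-- The maximal cliques of the induced subgraph of `G` on `S`. If `S` is empty, the empty
clique is the only one. -/
def MaxClique {V : Type*} (G : SimpleGraph V) (S : Set V) : Type _ :=
  {c : Set V // Maximal (fun c => c ⊆ S ∧ G.IsClique c) c}

/-- A graph factor system `𝔉` on `G` all of whose strict chains have fewer than `n` members.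
Its members, the domains, are non-empty induced subgraphs. -/
structure IsGraphFactorSystem {V : Type*} (G : SimpleGraph V) (𝔉 : Set (Set V)) (n : ℕ) :
    Prop where
  nonempty_of_mem : ∀ F ∈ 𝔉, F.Nonempty
  univ_mem : Set.univ ∈ 𝔉
  link_mem : ∀ v : V, (link G {v}).Nonempty → link G {v} ∈ 𝔉
  inter_mem : ∀ F₁ ∈ 𝔉, ∀ F₂ ∈ 𝔉, (F₁ ∩ F₂).Nonempty → F₁ ∩ F₂ ∈ 𝔉
  chain_lt : ∀ (k : ℕ) (c : Fin k → Set V), (∀ i, c i ∈ 𝔉) → StrictMono c → k < n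

/-! ### Augmented graphs, projection parts, complement graphs

`Sum.inl v` stands for the vertex `v` and `Sum.inr F` for the projection vertex `b_F`. -/

/-- The three kinds of edges of an augmented graph, where `W` is an `S`-graph, that is, a graph
on the maximal cliques of `S`: edges of `G`, additional edges, and edges from `b_F` to the vertices
of `F`. The augmented graphs are obtained from it by restricting to the right vertices. -/
def edgeGraph {V : Type*} (G : SimpleGraph V) (S : Set V) (W : SimpleGraph (MaxClique G S)) :
    SimpleGraph (V ⊕ Set V) where
  Adj
    | .inl v, .inl w =>
        v ≠ w ∧ (G.Adj v w ∨ ∃ x y : MaxClique G S, W.Adj x y ∧ v ∈ x.1 ∧ w ∈ y.1)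
    | .inl v, .inr F => v ∈ F
    | .inr F, .inl v => v ∈ F
    | .inr _, .inr _ => False
  symm := ⟨by
    rintro (v | F) (w | F') h
    · obtain ⟨hne, h | ⟨x, y, hxy, hv, hw⟩⟩ := h
      · exact ⟨hne.symm, Or.inl h.symm⟩
      · exact ⟨hne.symm, Or.inr ⟨y, x, hxy.symm, hw, hv⟩⟩
    · exact h
    · exact h
    · exact h⟩
  loopless := ⟨by
    rintro (v | F) h
    · exact h.1 rfl
    · exact h⟩

/-- The vertex set of the augmented graph of `F`: the vertices of `F` and the projection vertices
of the domains properly contained in `F`. -/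
def augVerts {V : Type*} (𝔉 : Set (Set V)) (F : Set V) : Set (V ⊕ Set V) :=
  {a | (∃ v ∈ F, a = Sum.inl v) ∨ ∃ H ∈ 𝔉, H ⊂ F ∧ a = Sum.inr H}

/-- The augmented graph of a domain `F ⊆ S`, computed in the triple given by the graph `S`, the
`S`-graph `W` and the domains contained in `S`. For `S = Set.univ` this is `CF`, and for
`S = F = Set.univ` it is `CX`. -/
def augGraph {V : Type*} (G : SimpleGraph V) (𝔉 : Set (Set V)) (S : Set V)
    (W : SimpleGraph (MaxClique G S)) (F : Set V) : SimpleGraph (augVerts 𝔉 F) :=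
  (edgeGraph G S W).induce (augVerts 𝔉 F)

/-- The projection part `PF`: the link of `F`, the projection vertices of the domains contained
in the link of `F` (including that of the link itself, if it is non-empty), and the
projection vertices of the non-maximal domains containing `F`. -/
def projPart {V : Type*} (G : SimpleGraph V) (𝔉 : Set (Set V)) (F : Set V) : Set (V ⊕ Set V) :=
  {a | (∃ v ∈ link G F, a = Sum.inl v) ∨
    (∃ H ∈ 𝔉, H ⊆ link G F ∧ a = Sum.inr H) ∨
    (∃ H ∈ 𝔉, H ≠ Set.univ ∧ F ⊆ H ∧ a = Sum.inr H)}

/-- The vertex set of the complement graph `Y_F`. -/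
def complVerts {V : Type*} (G : SimpleGraph V) (𝔉 : Set (Set V)) (F : Set V) :
    Set (V ⊕ Set V) :=
  augVerts 𝔉 Set.univ \ projPart G 𝔉 F

/-- The complement graph `Y_F`, an induced subgraph of `CX`. -/
def complGraph {V : Type*} (G : SimpleGraph V) (𝔉 : Set (Set V))
    (W : SimpleGraph (MaxClique G Set.univ)) (F : Set V) : SimpleGraph (complVerts G 𝔉 F) :=
  (edgeGraph G Set.univ W).induce (complVerts G 𝔉 F)

theorem complVerts_subset {V : Type*} (G : SimpleGraph V) (𝔉 : Set (Set V)) (F : Set V) :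
    complVerts G 𝔉 F ⊆ augVerts 𝔉 Set.univ :=
  Set.sdiff_subset

/-- `CF` is a subgraph of `Y_F`. -/
theorem augVerts_subset_complVerts {V : Type*} {G : SimpleGraph V} {𝔉 : Set (Set V)} {n : ℕ}
    (h : IsGraphFactorSystem G 𝔉 n) (F : Set V) : augVerts 𝔉 F ⊆ complVerts G 𝔉 F := by
  rintro a (⟨v, hv, rfl⟩ | ⟨H, hH, hHF, rfl⟩)
  · refine ⟨Or.inl ⟨v, trivial, rfl⟩, ?_⟩
    rintro (⟨w, hw, hvw⟩ | ⟨H, _, _, hh⟩ | ⟨H, _, _, _, hh⟩)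
    · cases hvw
      exact G.loopless.irrefl v (hw v hv)
    · cases hh
    · cases hh
  · refine ⟨Or.inr ⟨H, hH, lt_of_lt_of_le hHF (Set.subset_univ F), rfl⟩, ?_⟩
    rintro (⟨w, _, hh⟩ | ⟨K, _, hK, hh⟩ | ⟨K, _, _, hK, hh⟩)
    · cases hh
    · cases hh
      obtain ⟨v, hv⟩ := h.nonempty_of_mem H hH
      exact G.loopless.irrefl v (hK hv v (hHF.1 hv))
    · cases hh
      exact hHF.2 hK

/-! ### Combinatorial HHS with factor system -/

/-- The `δ`-hyperbolicity condition: every `CF` is `δ`-hyperbolic and its inclusion into `Y_F` is a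
`(δ, δ)`-quasi-isometric embedding. -/
def HyperbolicityCondition {V : Type*} {G : SimpleGraph V} {𝔉 : Set (Set V)} {n : ℕ}
    (h : IsGraphFactorSystem G 𝔉 n) (W : SimpleGraph (MaxClique G Set.univ)) (δ : ℝ) : Prop :=
  ∀ F ∈ 𝔉, IsHyperbolic (augGraph G 𝔉 Set.univ W F) δ ∧
    IsQIEmbedding (augGraph G 𝔉 Set.univ W F) (complGraph G 𝔉 W F) δ
      (Set.inclusion (augVerts_subset_complVerts h F))

/-- The hierarchy condition: every domain `F` carries an `F`-graph `WF F` such that, for all domains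
`F' ⊆ F`, the augmented graph of `F'` computed in `F` is `CF'`, and each (possibly empty) maximal
clique `x` in the part of the link of `F'` inside `F` induces a map of graphs from `WF F'` to `WF F`
(adjacent vertices have equal or adjacent images) that sends each maximal clique `w` of `F'` to
a maximal clique of `F` containing the join of `x` and `w`. -/
def HierarchyCondition {V : Type*} (G : SimpleGraph V) (𝔉 : Set (Set V))
    (W : SimpleGraph (MaxClique G Set.univ)) : Prop :=
  ∃ WF : (F : Set V) → SimpleGraph (MaxClique G F),
    ∀ F ∈ 𝔉, ∀ F' ∈ 𝔉, F' ⊆ F →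
      augGraph G 𝔉 F (WF F) F' = augGraph G 𝔉 Set.univ W F' ∧
      ∀ x : MaxClique G (link G F' ∩ F),
        ∃ φ : MaxClique G F' → MaxClique G F,
          (∀ w, x.1 ∪ w.1 ⊆ (φ w).1) ∧
          ∀ w w', (WF F').Adj w w' → φ w = φ w' ∨ (WF F).Adj (φ w) (φ w')

/-- `(X, W, 𝔉)` is an `(n, δ)`-CHHF (combinatorial HHS with factor system), where `X` is the
graph `G` and `W` is a graph on the maximal cliques of `G`. -/
structure IsCHHF {V : Type*} (G : SimpleGraph V) (W : SimpleGraph (MaxClique G Set.univ))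
    (𝔉 : Set (Set V)) (n : ℕ) (δ : ℝ) : Prop where
  factorSystem : IsGraphFactorSystem G 𝔉 n
  hyperbolicity : HyperbolicityCondition factorSystem W δ
  hierarchy : HierarchyCondition G 𝔉 W

/-- The coarse closest-point projection `p_F` from `Y_F` to the subsets of `CF`: the vertices `a` of
`CF` whose distance to `x` in `Y_F` is at most the distance from `x` to `CF` plus one. -/
noncomputable def closestProj {V : Type*} {G : SimpleGraph V} {𝔉 : Set (Set V)} {n : ℕ}
    (h : IsGraphFactorSystem G 𝔉 n) (W : SimpleGraph (MaxClique G Set.univ)) (F : Set V)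
    (x : complVerts G 𝔉 F) : Set (augVerts 𝔉 F) :=
  {a | (complGraph G 𝔉 W F).edist x (Set.inclusion (augVerts_subset_complVerts h F) a) ≤
    (⨅ z : augVerts 𝔉 F,
      (complGraph G 𝔉 W F).edist x (Set.inclusion (augVerts_subset_complVerts h F) z)) + 1}

end CHHF

/-!
If `b_F` is adjacent to all vertices of `CF`, a geodesic of `CX` avoiding `b_F` should have bounded
projection to `CF`. More precisely, in a hyperbolic graph `Z` the gates at a vertex `c` of the ends
of a geodesic avoiding `c` (the penultimate vertices of geodesics to `c`) are joined by a short path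
avoiding `c`. This is applied with `c = b_F` in a graph `Z` in which `b_F` is the only vertex of the
projection part of `F`; the gates at `b_F` are then close in `Y_F` to closest-point projections to
`CF`, and `CF` is undistorted in `Y_F`.

To see that `Z` is hyperbolic, first remove from `CX`, and from each `CH` with `F ⊆ H`, the link
of `F` and the cone points of the domains in it: excursions into the link can be replaced by
bounded detours, because the cone point of `lk(u) ∩ H`, for `u` in the link, is adjacent to all
of `F` and to all neighbours of `u` in `H`. Then remove the cone points `b_H` with `F ⊊ H` in
decreasing order of rank. Each is a cone over a hyperbolic, undistorted subgraph, and
hyperbolicity survives because geodesics can be guessed: replace the passage of a geodesic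
through `b_H` by a geodesic of that subgraph.
-/

namespace CHHF

open SimpleGraph

/-! ### Coarse distances and geodesics -/

/-- The vertices `x` and `y` are at distance at most `n`. In contrast to `H.dist x y ≤ n`, where
`H.dist` has the junk value `0`, this fails for vertices of different components. -/
def Near {A : Type*} (H : SimpleGraph A) (n : ℕ) (x y : A) : Prop :=
  H.edist x y ≤ n

section Near

variable {A : Type*} {H H' : SimpleGraph A} {x y z : A} {m n : ℕ}

theorem near_of_walk (p : H.Walk x y) (hp : p.length ≤ n) : Near H n x y :=
  (H.edist_le p).trans (Nat.cast_le.2 hp)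

theorem Near.ne_top (h : Near H n x y) : H.edist x y ≠ ⊤ :=
  ne_top_of_le_ne_top (ENat.natCast_ne_top n) h

theorem Near.reachable (h : Near H n x y) : H.Reachable x y :=
  reachable_of_edist_ne_top h.ne_top

theorem Near.exists_walk (h : Near H n x y) : ∃ p : H.Walk x y, p.length ≤ n := by
  obtain ⟨p, hp⟩ := exists_walk_of_edist_ne_top h.ne_top
  exact ⟨p, Nat.cast_le.1 (hp.trans_le h)⟩

theorem near_iff_reachable_and_dist_le : Near H n x y ↔ H.Reachable x y ∧ H.dist x y ≤ n := by
  refine ⟨fun h ↦ ⟨h.reachable, Nat.cast_le.1 (h.reachable.coe_dist_eq_edist.trans_le h)⟩, ?_⟩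
  rintro ⟨h, hd⟩
  rwa [Near, ← h.coe_dist_eq_edist, Nat.cast_le]

theorem Near.refl (H : SimpleGraph A) (n : ℕ) (x : A) : Near H n x x :=
  H.edist_self.trans_le zero_le

theorem Near.of_eq (h : x = y) : Near H n x y := h ▸ Near.refl H n x

theorem Near.of_adj (h : H.Adj x y) : Near H 1 x y :=
  edist_le_one_iff_adj_or_eq.2 (.inl h)

theorem Near.symm (h : Near H n x y) : Near H n y x := by
  rwa [Near, edist_comm]

theorem Near.trans (h : Near H m x y) (h' : Near H n y z) : Near H (m + n) x z :=
  H.edist_triangle.trans ((add_le_add h h').trans_eq (Nat.cast_add m n).symm)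

theorem Near.mono (hmn : m ≤ n) (h : Near H m x y) : Near H n x y :=
  le_trans h (Nat.cast_le.2 hmn)

theorem Near.mono_graph (hH : H ≤ H') (h : Near H n x y) : Near H' n x y :=
  (edist_anti hH).trans h

theorem IsGeodesic.length_le {p : H.Walk x y} (h : IsGeodesic p) (q : H.Walk x y) :
    p.length ≤ q.length :=
  h.trans_le (dist_le q)

theorem IsGeodesic.length_le_of_near {p : H.Walk x y} (h : IsGeodesic p) (hn : Near H n x y) :
    p.length ≤ n :=
  h.trans_le (near_iff_reachable_and_dist_le.1 hn).2

theorem IsGeodesic.reverse {p : H.Walk x y} (h : IsGeodesic p) : IsGeodesic p.reverse := by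
  rw [IsGeodesic, Walk.length_reverse, dist_comm]
  exact h

theorem IsGeodesic.of_isSubwalk {u v : A} {p : H.Walk x y} {q : H.Walk u v} (h : IsGeodesic p)
    (hq : q.IsSubwalk p) : IsGeodesic q :=
  length_eq_dist_of_subwalk h hq

theorem IsGeodesic.take {p : H.Walk x y} (h : IsGeodesic p) (i : ℕ) : IsGeodesic (p.take i) :=
  h.of_isSubwalk (p.isSubwalk_take i)

theorem IsGeodesic.drop {p : H.Walk x y} (h : IsGeodesic p) (i : ℕ) : IsGeodesic (p.drop i) :=
  h.of_isSubwalk (p.isSubwalk_drop i)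

theorem IsGeodesic.append_left {p : H.Walk x y} {q : H.Walk y z} (h : IsGeodesic (p.append q)) :
    IsGeodesic p :=
  h.of_isSubwalk (Walk.isSubwalk_of_append_left rfl)

theorem IsGeodesic.append_right {p : H.Walk x y} {q : H.Walk y z} (h : IsGeodesic (p.append q)) :
    IsGeodesic q :=
  h.of_isSubwalk (Walk.isSubwalk_of_append_right rfl)

theorem isGeodesic_of_adj (h : H.Adj x y) : IsGeodesic (.cons h .nil : H.Walk x y) :=
  (dist_eq_one_iff_adj.2 h).symm

theorem exists_isSubwalk_getVert (p : H.Walk x y) {i j : ℕ} (hij : i ≤ j) :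
    ∃ q : H.Walk (p.getVert i) (p.getVert j), q.IsSubwalk p ∧ q.length ≤ j - i := by
  have hj : (p.drop i).getVert (j - i) = p.getVert j := by
    rw [Walk.drop_getVert, Nat.add_sub_cancel' hij]
  refine ⟨((p.drop i).take (j - i)).copy rfl hj,
    (((p.drop i).isSubwalk_take _).trans (p.isSubwalk_drop i)).copy rfl hj rfl rfl, ?_⟩
  rw [Walk.length_copy, Walk.take_length]
  exact min_le_left _ _

theorem near_getVert (p : H.Walk x y) {i j : ℕ} (hij : i ≤ j) :
    Near H (j - i) (p.getVert i) (p.getVert j) := by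
  obtain ⟨q, -, hq⟩ := exists_isSubwalk_getVert p hij
  exact near_of_walk q hq

theorem near_of_mem_support {p : H.Walk x y} {u v : A} (hu : u ∈ p.support) (hv : v ∈ p.support) :
    Near H p.length u v := by
  obtain ⟨i, rfl, hi⟩ := Walk.mem_support_iff_exists_getVert.1 hu
  obtain ⟨j, rfl, hj⟩ := Walk.mem_support_iff_exists_getVert.1 hv
  rcases le_total i j with hij | hij
  · exact (near_getVert p hij).mono (by omega)
  · exact (near_getVert p hij).symm.mono (by omega)

theorem IsGeodesic.le_add_of_near {p : H.Walk x y} (hp : IsGeodesic p) {i j : ℕ}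
    (hj : j ≤ p.length) (h : Near H n (p.getVert i) (p.getVert j)) : j ≤ i + n := by
  obtain ⟨q, hq⟩ := h.exists_walk
  have := hp.length_le (((p.take i).append q).append (p.drop j))
  simp only [Walk.length_append, Walk.take_length, Walk.drop_length] at this
  omega

end Near

/-! ### Guessing geodesics -/

/-- Geodesic triangles of `H` are `δ`-slim. -/
def Slim {A : Type*} (H : SimpleGraph A) (δ : ℕ) : Prop :=
  ∀ (a b c : A) (p : H.Walk a b) (q : H.Walk b c) (r : H.Walk a c),
    IsGeodesic p → IsGeodesic q → IsGeodesic r →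
      ∀ u ∈ p.support, ∃ v, (v ∈ q.support ∨ v ∈ r.support) ∧ Near H δ u v

/-- A family of guesses `L x y` at the geodesics from `x` to `y`: the sets `L x y` are coarsely
connected (`cut`) and form slim triangles (`thin`). -/
structure GuessFamily {A : Type*} (H : SimpleGraph A) (L : A → A → Set A) (h : ℕ) : Prop where
  thin : ∀ x y z, ∀ u ∈ L x y, ∃ v, (v ∈ L x z ∨ v ∈ L z y) ∧ Near H h u v
  small : ∀ x y, Near H 1 x y → ∀ u ∈ L x y, Near H h u x
  cut : ∀ x y, ∀ P : Set A, x ∈ P → y ∉ P → ∃ u ∈ L x y, ∃ v ∈ L x y, u ∈ P ∧ v ∉ P ∧ Near H h u v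
  right_mem : ∀ x y, y ∈ L x y

/-- Each `L x y` lies in the `t`-neighbourhood of every geodesic from `x` to `y` of length at most
`m`. -/
def TracksGeodesics {A : Type*} (H : SimpleGraph A) (L : A → A → Set A) (m t : ℕ) : Prop :=
  ∀ (x y : A) (γ : H.Walk x y), IsGeodesic γ → γ.length ≤ m →
    ∀ u ∈ L x y, ∃ v ∈ γ.support, Near H t u v

theorem exists_le_two_pow_and_mul_le (h t : ℕ) (ht : 16 * (h + 1) ^ 2 ≤ t) :
    ∃ k, t + 2 * h + 2 ≤ 2 ^ k ∧ h * (k + 3) ≤ t := by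
  have hdiv : t < 2 * (h + 1) * (t / (2 * (h + 1)) + 1) := by
    have := Nat.lt_div_mul_add (a := t) (b := 2 * (h + 1)) (by omega)
    nlinarith
  have hdiv' : 2 * (h + 1) * (t / (2 * (h + 1))) ≤ t := Nat.mul_div_le _ _
  have hk : 8 * (h + 1) ≤ t / (2 * (h + 1)) := by
    rw [Nat.le_div_iff_mul_le (by omega)]
    nlinarith
  generalize t / (2 * (h + 1)) = k at *
  refine ⟨k, ?_, by nlinarith⟩
  have hsq : (k / 2 + 1) * (k / 2 + 1) ≤ 2 ^ k :=
    calc (k / 2 + 1) * (k / 2 + 1)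
        ≤ 2 ^ (k / 2) * 2 ^ (k / 2) := Nat.mul_le_mul Nat.lt_two_pow_self Nat.lt_two_pow_self
      _ = 2 ^ (k / 2 + k / 2) := (pow_add 2 _ _).symm
      _ ≤ 2 ^ k := Nat.pow_le_pow_right (by omega) (by omega)
  have h4 : 4 * (h + 1) ≤ k / 2 := by omega
  have h5 : k ≤ 2 * (k / 2) + 1 := by omega
  generalize k / 2 = a at *
  nlinarith

namespace GuessFamily

variable {A : Type*} {H : SimpleGraph A} {L : A → A → Set A} {h : ℕ}

theorem preconnected (hL : GuessFamily H L h) : H.Preconnected := by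
  intro x y
  by_contra hxy
  obtain ⟨u, -, v, -, hu, hv, huv⟩ :=
    hL.cut x y {z | H.Reachable x z} (Reachable.refl x) hxy
  exact hv (hu.trans huv.reachable)

theorem near_walk (hL : GuessFamily H L h) (k : ℕ) {x y : A} (p : H.Walk x y)
    (hp : p.length ≤ 2 ^ k) {u : A} (hu : u ∈ L x y) :
    ∃ v ∈ p.support, Near H (h * (k + 1)) u v := by
  induction k generalizing x y u with
  | zero =>
    refine ⟨x, p.start_mem_support, ?_⟩
    simpa using hL.small x y (near_of_walk p hp) u hu
  | succ k ih =>
    obtain ⟨w, hw, huw⟩ := hL.thin x y (p.getVert (2 ^ k)) u hu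
    have hw' : ∃ v ∈ p.support, Near H (h * (k + 1)) w v := by
      rcases hw with hw | hw
      · obtain ⟨v, hv, hwv⟩ := ih (p.take (2 ^ k)) (by rw [Walk.take_length]; omega) hw
        exact ⟨v, (p.isSubwalk_take _).support_subset hv, hwv⟩
      · obtain ⟨v, hv, hwv⟩ := ih (p.drop (2 ^ k))
          (by rw [Walk.drop_length]; rw [pow_succ] at hp; omega) hw
        exact ⟨v, (p.isSubwalk_drop _).support_subset hv, hwv⟩
    obtain ⟨v, hv, hwv⟩ := hw'
    exact ⟨v, hv, (huw.trans hwv).mono (by rw [Nat.mul_succ h (k + 1), add_comm])⟩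

theorem near_subwalk (hL : GuessFamily H L h) {k i j : ℕ} {x y : A} (p : H.Walk x y)
    (hij : i ≤ j) (hji : j ≤ i + 2 ^ k) {u : A} (hu : u ∈ L (p.getVert i) (p.getVert j)) :
    ∃ v ∈ p.support, Near H (h * (k + 1)) u v := by
  obtain ⟨q, hqp, hq⟩ := exists_isSubwalk_getVert p hij
  obtain ⟨v, hv, huv⟩ := hL.near_walk k q (by omega) hu
  exact ⟨v, hqp.support_subset hv, huv⟩

theorem exists_consecutive_near (hL : GuessFamily H L h) {x y : A} (p : H.Walk x y) {u : A}
    (hu : u ∈ L x y) (hux : ¬ Near H (h + h) u x) :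
    ∃ s, (∃ w ∈ L (p.getVert s) y, Near H h u w) ∧
      ∃ w ∈ L x (p.getVert (s + 1)), Near H h u w := by
  classical
  have hex : ∃ s, ∃ w ∈ L x (p.getVert s), Near H h u w :=
    ⟨p.length, u, by rwa [Walk.getVert_length], Near.refl H h u⟩
  obtain ⟨w, hw, huw⟩ := Nat.find_spec hex
  have hne : Nat.find hex ≠ 0 := by
    intro h0
    rw [h0, Walk.getVert_zero] at hw
    exact hux (huw.trans (hL.small x x (Near.refl H 1 x) w hw))
  obtain ⟨s, hs⟩ := Nat.exists_eq_succ_of_ne_zero hne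
  rw [hs] at hw
  refine ⟨s, ?_, w, hw, huw⟩
  obtain ⟨w', hw' | hw', huw'⟩ := hL.thin x y (p.getVert s) u hu
  · exact absurd ⟨w', hw', huw'⟩ (Nat.find_min hex (by omega))
  · exact ⟨w', hw', huw'⟩

/-- If `L x (p.getVert s)` passes near a point `u` far from `p`, then so does `L x (p.getVert i)`
for `i` well before `s`: otherwise `u` would be close to the guess for a short piece of `p`. -/
theorem exists_near_left (hL : GuessFamily H L h) {k r s t : ℕ} {x y : A} (p : H.Walk x y) {u : A}
    (hu : ∀ v ∈ p.support, ¬ Near H t u v) (hrk : r ≤ 2 ^ k) (hkt : h * (k + 3) ≤ t)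
    (hs : ∃ w ∈ L x (p.getVert s), Near H h u w) :
    r ≤ s ∧ ∃ w ∈ L x (p.getVert (s - r)), Near H (h + h) u w := by
  obtain ⟨w, hw, huw⟩ := hs
  have hw' : ∃ w ∈ L x (p.getVert (s - r)), Near H (h + h) u w := by
    obtain ⟨w', hw' | hw', hww'⟩ := hL.thin x _ (p.getVert (s - r)) w hw
    · exact ⟨w', hw', huw.trans hww'⟩
    · obtain ⟨v, hv, hwv⟩ := hL.near_subwalk (k := k) p (by omega) (by omega) hw'
      exact absurd (((huw.trans hww').trans hwv).mono (by linarith)) (hu v hv)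
  refine ⟨?_, hw'⟩
  by_contra hrs
  obtain ⟨w', hw', huw'⟩ := hw'
  rw [show s - r = 0 by omega, Walk.getVert_zero] at hw'
  exact hu x p.start_mem_support
    ((huw'.trans (hL.small x x (Near.refl H 1 x) w' hw')).mono (by nlinarith))

theorem exists_near_right (hL : GuessFamily H L h) {k r s t : ℕ} {x y : A} (p : H.Walk x y) {u : A}
    (hu : ∀ v ∈ p.support, ¬ Near H t u v) (hrk : r ≤ 2 ^ k) (hkt : h * (k + 3) ≤ t)
    (hs : ∃ w ∈ L (p.getVert s) y, Near H h u w) :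
    s + r ≤ p.length ∧ ∃ w ∈ L (p.getVert (s + r)) y, Near H (h + h) u w := by
  obtain ⟨w, hw, huw⟩ := hs
  have hw' : ∃ w ∈ L (p.getVert (s + r)) y, Near H (h + h) u w := by
    obtain ⟨w', hw' | hw', hww'⟩ := hL.thin _ y (p.getVert (s + r)) w hw
    · obtain ⟨v, hv, hwv⟩ := hL.near_subwalk (k := k) p (by omega) (by omega) hw'
      exact absurd (((huw.trans hww').trans hwv).mono (by linarith)) (hu v hv)
    · exact ⟨w', hw', huw.trans hww'⟩
  refine ⟨?_, hw'⟩
  by_contra hrs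
  obtain ⟨w', hw', huw'⟩ := hw'
  rw [p.getVert_of_length_le (by omega)] at hw'
  exact hu y p.end_mem_support
    ((huw'.trans (hL.small y y (Near.refl H 1 y) w' hw')).mono (by nlinarith))

/-- A point `u` of a guess at distance more than `t` from the geodesic `γ` would be close to the
guesses for two subgeodesics of `γ` that are far from each other, hence to both subgeodesics. -/
theorem tracksGeodesics_of_succ (hL : GuessFamily H L h) {m t : ℕ} (ht : 16 * (h + 1) ^ 2 ≤ t)
    (hm : TracksGeodesics H L m (t + 1)) : TracksGeodesics H L m t := by
  intro x y γ hγ hγm u hu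
  by_contra! hfar
  obtain ⟨k, hk, hkt⟩ := exists_le_two_pow_and_mul_le h t ht
  obtain ⟨s, hs, hs'⟩ := hL.exists_consecutive_near γ hu
    fun hn ↦ hfar x γ.start_mem_support (hn.mono (by nlinarith))
  obtain ⟨hls, w, hw, huw⟩ := hL.exists_near_left γ hfar hk hkt hs'
  obtain ⟨hrs, w', hw', huw'⟩ := hL.exists_near_right γ hfar hk hkt hs
  obtain ⟨v, hv, hwv⟩ := hm x _ (γ.take _) (hγ.take _) (by rw [Walk.take_length]; omega) w hw
  obtain ⟨v', hv', hwv'⟩ := hm _ y (γ.drop _) (hγ.drop _) (by rw [Walk.drop_length]; omega) w' hw'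
  obtain ⟨i, rfl, hi⟩ := Walk.mem_support_iff_exists_getVert.1 hv
  obtain ⟨j, rfl, hj⟩ := Walk.mem_support_iff_exists_getVert.1 hv'
  rw [Walk.take_length] at hi
  rw [Walk.drop_length] at hj
  rw [Walk.take_getVert] at hwv
  rw [Walk.drop_getVert] at hwv'
  have := hγ.le_add_of_near (by omega) ((huw.trans hwv).symm.trans (huw'.trans hwv'))
  omega

theorem tracksGeodesics (hL : GuessFamily H L h) (m : ℕ) :
    TracksGeodesics H L m (16 * (h + 1) ^ 2) := by
  have hdesc : ∀ d, TracksGeodesics H L m (16 * (h + 1) ^ 2 + d) →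
      TracksGeodesics H L m (16 * (h + 1) ^ 2) := by
    intro d
    induction d with
    | zero => exact id
    | succ d ih => exact fun hd ↦ ih (hL.tracksGeodesics_of_succ (by omega) hd)
  refine hdesc (h * (m + 1)) fun x y γ _ hγm u hu ↦ ?_
  obtain ⟨v, hv, huv⟩ := hL.near_walk m γ (hγm.trans Nat.lt_two_pow_self.le) hu
  exact ⟨v, hv, huv.mono (Nat.le_add_left _ _)⟩

theorem near_geodesic (hL : GuessFamily H L h) {x y : A} {γ : H.Walk x y} (hγ : IsGeodesic γ)
    {u : A} (hu : u ∈ L x y) : ∃ v ∈ γ.support, Near H (16 * (h + 1) ^ 2) u v :=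
  hL.tracksGeodesics γ.length x y γ hγ le_rfl u hu

theorem geodesic_near (hL : GuessFamily H L h) {x y : A} {γ : H.Walk x y} (hγ : IsGeodesic γ)
    {u : A} (hu : u ∈ γ.support) : ∃ v ∈ L x y, Near H (48 * (h + 1) ^ 2 + h) u v := by
  set D := 16 * (h + 1) ^ 2
  obtain ⟨s, rfl, hs⟩ := Walk.mem_support_iff_exists_getVert.1 hu
  by_cases hy : y ∈ {w | ∃ i ≤ s, Near H D w (γ.getVert i)}
  · obtain ⟨i, his, hi⟩ := hy
    have hle := hγ.le_add_of_near (i := i) le_rfl (by simpa using hi.symm)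
    have hnear := near_getVert γ hs
    rw [Walk.getVert_length] at hnear
    exact ⟨y, hL.right_mem x y, hnear.mono (by omega)⟩
  · obtain ⟨w, hw, w', hw', ⟨i, his, hi⟩, hnot, hww'⟩ := hL.cut x y
      {w | ∃ i ≤ s, Near H D w (γ.getVert i)} ⟨0, Nat.zero_le s, .of_eq γ.getVert_zero.symm⟩ hy
    obtain ⟨v, hv, hn⟩ := hL.near_geodesic hγ hw'
    obtain ⟨j, rfl, hj⟩ := Walk.mem_support_iff_exists_getVert.1 hv
    have hsj : s < j := not_le.1 fun hjs ↦ hnot ⟨j, hjs, hn⟩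
    have hle := hγ.le_add_of_near hj ((hi.symm.trans hww').trans hn)
    exact ⟨w, hw, (hi.trans (near_getVert γ his)).symm.mono (by omega)⟩

theorem slim (hL : GuessFamily H L h) : Slim H (64 * (h + 1) ^ 2 + 2 * h) := by
  intro a b c p q r hp hq hr u hu
  obtain ⟨v, hv, huv⟩ := hL.geodesic_near hp hu
  obtain ⟨w, hw | hw, hvw⟩ := hL.thin a b c v hv
  · obtain ⟨z, hz, hwz⟩ := hL.near_geodesic hr hw
    exact ⟨z, .inr hz, ((huv.trans hvw).trans hwz).mono (by omega)⟩
  · obtain ⟨z, hz, hwz⟩ := hL.near_geodesic hq.reverse hw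
    rw [Walk.support_reverse, List.mem_reverse] at hz
    exact ⟨z, .inl hz, ((huv.trans hvw).trans hwz).mono (by omega)⟩

end GuessFamily

/-! ### Hyperbolicity of induced subgraphs -/

/-- The graph on all of `A` whose edges are the edges of `E` with both ends in `S`. It has the same
walks between vertices of `S` as `E.induce S`, but comparing different `S` needs no coercions. -/
def restr {A : Type*} (E : SimpleGraph A) (S : Set A) : SimpleGraph A :=
  ((⊤ : E.Subgraph).induce S).spanningCoe

section restr

variable {A : Type*} {E : SimpleGraph A} {S S' : Set A} {x y : A} {n : ℕ}

theorem restr_adj : (restr E S).Adj x y ↔ x ∈ S ∧ y ∈ S ∧ E.Adj x y :=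
  Iff.rfl

theorem restr_le : restr E S ≤ E :=
  fun _ _ h ↦ h.2.2

theorem restr_mono (h : S ⊆ S') : restr E S ≤ restr E S' :=
  fun _ _ hxy ↦ ⟨h hxy.1, h hxy.2.1, hxy.2.2⟩

theorem restr_restr (E : SimpleGraph A) (S S' : Set A) :
    restr (restr E S) S' = restr E (S ∩ S') := by
  ext x y
  simp only [restr_adj, Set.mem_inter_iff]
  tauto

theorem mem_of_mem_support_restr (hx : x ∈ S) (p : (restr E S).Walk x y) :
    ∀ v ∈ p.support, v ∈ S := by
  induction p with
  | nil => simpa using hx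
  | cons h p ih =>
    rw [Walk.support_cons, List.forall_mem_cons]
    exact ⟨hx, ih h.2.1⟩

theorem eq_of_walk_restr (hx : x ∉ S) (p : (restr E S).Walk x y) : x = y := by
  cases p with
  | nil => rfl
  | cons h p => exact absurd h.1 hx

/-- The induced subgraph on `S`, mapped to `restr E S`. -/
def induceHom (E : SimpleGraph A) (S : Set A) : E.induce S →g restr E S where
  toFun := Subtype.val
  map_rel' h := ⟨Subtype.property _, Subtype.property _, h⟩

theorem length_induce (p : E.Walk x y) (hp : ∀ v ∈ p.support, v ∈ S) :
    (p.induce S hp).length = p.length :=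
  (Walk.length_map _ _).symm.trans (congrArg Walk.length (p.map_induce hp))

theorem exists_walk_restr (p : E.Walk x y) (hp : ∀ v ∈ p.support, v ∈ S) :
    ∃ q : (restr E S).Walk x y, q.length = p.length ∧ q.support = p.support := by
  let q : (restr E S).Walk x y := (p.induce S hp).map (induceHom E S)
  have hsupp : q.support = (p.induce S hp).support.map Subtype.val := Walk.support_map _ _
  refine ⟨q, (Walk.length_map _ _).trans (length_induce p hp), ?_⟩
  rw [hsupp, Walk.support_induce, List.attachWith_map_subtype_val]

theorem near_restr_of_walk (p : E.Walk x y) (hp : ∀ v ∈ p.support, v ∈ S) (hn : p.length ≤ n) :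
    Near (restr E S) n x y := by
  obtain ⟨q, hq, -⟩ := exists_walk_restr p hp
  exact near_of_walk q (hq.trans_le hn)

theorem exists_walk_induce {x y : S} (p : (restr E S).Walk x y) :
    ∃ q : (E.induce S).Walk x y, q.length = p.length ∧ ∀ v, v ∈ q.support ↔ v.1 ∈ p.support := by
  have hp : ∀ v ∈ (p.mapLe restr_le).support, v ∈ S := by
    rw [Walk.support_mapLe_eq_support]
    exact mem_of_mem_support_restr x.2 p
  refine ⟨(p.mapLe restr_le).induce S hp, ?_, fun v ↦ ?_⟩
  · rw [length_induce, Walk.length_map]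
  · rw [Walk.support_induce, List.mem_attachWith, Walk.support_mapLe_eq_support]

theorem near_restr_iff {x y : S} : Near (restr E S) n x.1 y.1 ↔ Near (E.induce S) n x y := by
  refine ⟨fun h ↦ ?_, fun h ↦ ?_⟩
  · obtain ⟨p, hp⟩ := h.exists_walk
    obtain ⟨q, hq, -⟩ := exists_walk_induce p
    exact near_of_walk q (hq.trans_le hp)
  · obtain ⟨p, hp⟩ := h.exists_walk
    exact near_of_walk (p.map (induceHom E S)) ((Walk.length_map _ _).trans_le hp)

theorem dist_restr {x y : S} : (restr E S).dist x y = (E.induce S).dist x y := by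
  rw [SimpleGraph.dist, SimpleGraph.dist]
  congr 1
  refine eq_of_forall_ge_iff fun m ↦ ?_
  induction m using ENat.recTopCoe with
  | top => simp
  | coe m => exact near_restr_iff

theorem exists_isGeodesic_induce {x y : S} {p : (restr E S).Walk x y} (hp : IsGeodesic p) :
    ∃ q : (E.induce S).Walk x y, IsGeodesic q ∧ ∀ v, v ∈ q.support ↔ v.1 ∈ p.support := by
  obtain ⟨q, hq, hqp⟩ := exists_walk_induce p
  exact ⟨q, hq.trans (hp.trans dist_restr), hqp⟩

theorem exists_isGeodesic_restr (hS : S ⊆ S') {x y : S'} {γ : (E.induce S').Walk x y}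
    (hγ : IsGeodesic γ) (hγS : ∀ v ∈ γ.support, v.1 ∈ S) :
    ∃ p : (restr E S).Walk x.1 y.1, IsGeodesic p ∧ ∀ v ∈ p.support, ∃ w ∈ γ.support, w.1 = v := by
  let γ' : E.Walk x.1 y.1 := γ.map (Embedding.induce S').toHom
  have hsupp : γ'.support = γ.support.map Subtype.val := Walk.support_map _ _
  have hlen : γ'.length = γ.length := Walk.length_map _ _
  obtain ⟨p, hp, hpγ⟩ := exists_walk_restr γ' (S := S) (by simpa [hsupp] using hγS)
  refine ⟨p, ?_, fun v hv ↦ List.mem_map.1 (hsupp ▸ hpγ ▸ hv)⟩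
  obtain ⟨q, hq⟩ := p.reachable.exists_walk_length_eq_dist
  obtain ⟨q', hq', -⟩ := exists_walk_induce (q.mapLe (restr_mono hS))
  have hle := hγ.length_le q'
  rw [hq', Walk.length_map] at hle
  exact le_antisymm (by omega) (dist_le p)

end restr

/-- The subgraph of `E` induced on `S` is connected (or empty), with `δ`-slim geodesic triangles. -/
structure HyperbolicOn {A : Type*} (E : SimpleGraph A) (S : Set A) (δ : ℕ) : Prop where
  preconnected_induce : (E.induce S).Preconnected
  slim_induce : Slim (E.induce S) δ

section HyperbolicOn

variable {A B : Type*} {E : SimpleGraph A} {S S' : Set A} {x y : A} {δ δ' N : ℕ}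

theorem Slim.mono {H : SimpleGraph A} (h : Slim H δ) (hδ : δ ≤ δ') : Slim H δ' := by
  intro a b c p q r hp hq hr u hu
  obtain ⟨v, hv, huv⟩ := h a b c p q r hp hq hr u hu
  exact ⟨v, hv, huv.mono hδ⟩

theorem HyperbolicOn.mono (h : HyperbolicOn E S δ) (hδ : δ ≤ δ') : HyperbolicOn E S δ' :=
  ⟨h.preconnected_induce, h.slim_induce.mono hδ⟩

theorem HyperbolicOn.reachable (h : HyperbolicOn E S δ) (hx : x ∈ S) (hy : y ∈ S) :
    (restr E S).Reachable x y :=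
  (h.preconnected_induce ⟨x, hx⟩ ⟨y, hy⟩).map (induceHom E S)

theorem HyperbolicOn.exists_isGeodesic (h : HyperbolicOn E S δ) (hx : x ∈ S) (hy : y ∈ S) :
    ∃ γ : (restr E S).Walk x y, IsGeodesic γ :=
  (h.reachable hx hy).exists_walk_length_eq_dist

theorem HyperbolicOn.slim (h : HyperbolicOn E S δ) : Slim (restr E S) δ := by
  intro a b c p q r hp hq hr u hu
  by_cases ha : a ∈ S
  · lift a to S using ha
    lift b to S using mem_of_mem_support_restr a.2 p b p.end_mem_support
    lift c to S using mem_of_mem_support_restr a.2 r c r.end_mem_support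
    lift u to S using mem_of_mem_support_restr a.2 p u hu
    obtain ⟨p', hp', hpp'⟩ := exists_isGeodesic_induce hp
    obtain ⟨q', hq', hqq'⟩ := exists_isGeodesic_induce hq
    obtain ⟨r', hr', hrr'⟩ := exists_isGeodesic_induce hr
    obtain ⟨v, hv, huv⟩ := h.slim_induce a b c p' q' r' hp' hq' hr' u ((hpp' u).2 hu)
    exact ⟨v, hv.imp (hqq' v).1 (hrr' v).1, near_restr_iff.2 huv⟩
  · have hua : a = u := by
      obtain ⟨s, -, -⟩ := Walk.mem_support_iff_exists_append.1 hu
      exact eq_of_walk_restr ha s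
    exact ⟨a, .inr r.start_mem_support, .of_eq hua.symm⟩

theorem GuessFamily.hyperbolicOn {L : S → S → Set S} {h : ℕ} (hL : GuessFamily (E.induce S) L h) :
    HyperbolicOn E S (64 * (h + 1) ^ 2 + 2 * h) :=
  ⟨hL.preconnected, hL.slim⟩

theorem IsHyperbolic.hyperbolicOn {δ : ℝ} (h : IsHyperbolic (E.induce S) δ) :
    HyperbolicOn E S ⌈δ⌉₊ := by
  refine ⟨h.1.preconnected, fun a b c p q r hp hq hr u hu ↦ ?_⟩
  obtain ⟨v, hv, huv⟩ := h.2 a b c p q r hp hq hr u hu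
  exact ⟨v, hv, near_iff_reachable_and_dist_le.2
    ⟨h.1.preconnected u v, Nat.cast_le.1 (huv.trans (Nat.le_ceil δ))⟩⟩

theorem exists_adj_of_walk {H : SimpleGraph A} (p : H.Walk x y) (P : Set A) (hx : x ∈ P)
    (hy : y ∉ P) : ∃ u ∈ p.support, ∃ v ∈ p.support, H.Adj u v ∧ u ∈ P ∧ v ∉ P := by
  obtain ⟨d, hd, hfst, hsnd⟩ := p.exists_boundary_dart P hx hy
  exact ⟨d.fst, p.dart_fst_mem_support_of_mem_darts hd, d.snd,
    p.dart_snd_mem_support_of_mem_darts hd, d.adj, hfst, hsnd⟩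

/-- The vertices of `H₁` whose image under `f` is close to a geodesic from `f x` to `f y`. -/
def nearGeodesics {H₀ : SimpleGraph A} {H₁ : SimpleGraph B} (f : H₁ →g H₀) (N : ℕ) (x y : B) :
    Set B :=
  {z | ∃ γ : H₀.Walk (f x) (f y), IsGeodesic γ ∧ ∃ p ∈ γ.support, Near H₀ N (f z) p}

theorem nearGeodesics_cut {H₀ : SimpleGraph A} {H₁ : SimpleGraph B} {f : H₁ →g H₀}
    (hconn : H₀.Preconnected) (hdense : ∀ v, ∃ w, Near H₀ N v (f w)) {x y : B} {P : Set B}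
    (hx : x ∈ P) (hy : y ∉ P) :
    ∃ u ∈ nearGeodesics f N x y, ∃ v ∈ nearGeodesics f N x y,
      u ∈ P ∧ v ∉ P ∧ Near H₀ (2 * N + 1) (f u) (f v) := by
  obtain ⟨γ, hγ⟩ := (hconn (f x) (f y)).exists_walk_length_eq_dist
  let Q : Set A := {v | ∃ z ∈ P, Near H₀ N (f z) v}
  by_cases hQ : f y ∈ Q
  · obtain ⟨z, hz, hzy⟩ := hQ
    exact ⟨z, ⟨γ, hγ, f y, γ.end_mem_support, hzy⟩, y, ⟨γ, hγ, f y, γ.end_mem_support, .refl _ _ _⟩,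
      hz, hy, hzy.mono (by omega)⟩
  · obtain ⟨u, hu, v, hv, huv, ⟨z, hz, hzu⟩, hnv⟩ :=
      exists_adj_of_walk γ Q ⟨x, hx, .refl _ _ _⟩ hQ
    obtain ⟨w, hvw⟩ := hdense v
    exact ⟨z, ⟨γ, hγ, u, hu, hzu⟩, w, ⟨γ, hγ, v, hv, hvw.symm⟩, hz,
      fun hw ↦ hnv ⟨w, hw, hvw.symm⟩, ((hzu.trans (.of_adj huv)).trans hvw).mono (by omega)⟩

theorem guessFamily_nearGeodesics {H₀ : SimpleGraph A} {H₁ : SimpleGraph B} {f : H₁ →g H₀}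
    (hconn : H₀.Preconnected) (hslim : Slim H₀ δ) (hdense : ∀ v, ∃ w, Near H₀ N v (f w))
    (hqi : ∀ m x y, Near H₀ m (f x) (f y) → Near H₁ (N * m) x y) :
    GuessFamily H₁ (nearGeodesics f N) (N * (2 * N + δ + 1)) := by
  have hqi' : ∀ m ≤ 2 * N + δ + 1, ∀ x y, Near H₀ m (f x) (f y) →
      Near H₁ (N * (2 * N + δ + 1)) x y :=
    fun m hm x y h ↦ (hqi m x y h).mono (Nat.mul_le_mul_left N hm)
  have hgeod (x y) : ∃ γ : H₀.Walk x y, IsGeodesic γ := (hconn x y).exists_walk_length_eq_dist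
  refine ⟨?thin, ?small, ?cut, ?right_mem⟩
  case thin =>
    rintro x y w z ⟨γ, hγ, p, hp, hzp⟩
    obtain ⟨γ₁, hγ₁⟩ := hgeod (f x) (f w)
    obtain ⟨γ₂, hγ₂⟩ := hgeod (f w) (f y)
    obtain ⟨v, hv, hpv⟩ := hslim _ _ _ γ γ₂.reverse γ₁ hγ hγ₂.reverse hγ₁ p hp
    obtain ⟨u, hvu⟩ := hdense v
    rw [Walk.support_reverse, List.mem_reverse] at hv
    exact ⟨u, hv.symm.imp (fun hv ↦ ⟨γ₁, hγ₁, v, hv, hvu.symm⟩)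
      (fun hv ↦ ⟨γ₂, hγ₂, v, hv, hvu.symm⟩),
      hqi' _ (by omega) z u ((hzp.trans hpv).trans hvu)⟩
  case small =>
    rintro x y hxy z ⟨γ, hγ, p, hp, hzp⟩
    have hlen : γ.length ≤ 1 := by
      obtain ⟨q, hq⟩ := hxy.exists_walk
      exact (hγ.length_le (q.map f)).trans (by rwa [Walk.length_map])
    exact hqi' (N + 1) (by omega) z x
      (hzp.trans ((near_of_mem_support hp γ.start_mem_support).mono hlen))
  case cut =>
    intro x y P hx hy
    obtain ⟨u, hu, v, hv, huP, hvP, huv⟩ := nearGeodesics_cut hconn hdense hx hy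
    exact ⟨u, hu, v, hv, huP, hvP, hqi' _ (by omega) u v huv⟩
  case right_mem =>
    intro x y
    obtain ⟨γ, hγ⟩ := hgeod (f x) (f y)
    exact ⟨γ, hγ, f y, γ.end_mem_support, .refl _ _ _⟩

theorem HyperbolicOn.of_dense (h : HyperbolicOn E S δ) (hS : S' ⊆ S)
    (hdense : ∀ v ∈ S, ∃ w ∈ S', Near (restr E S) N v w)
    (hqi : ∀ m, ∀ x ∈ S', ∀ y ∈ S', Near (restr E S) m x y → Near (restr E S') (N * m) x y) :
    HyperbolicOn E S' (64 * (N * (2 * N + δ + 1) + 1) ^ 2 + 2 * (N * (2 * N + δ + 1))) := by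
  refine (guessFamily_nearGeodesics (f := (E.induceHomOfLE hS).toHom) h.preconnected_induce
    h.slim_induce (fun v ↦ ?_) fun m x y hxy ↦ ?_).hyperbolicOn
  · obtain ⟨w, hw, hvw⟩ := hdense v v.2
    exact ⟨⟨w, hw⟩, near_restr_iff.1 hvw⟩
  · exact near_restr_iff.1 (hqi m x x.2 y y.2 (near_restr_iff.2 hxy))

end HyperbolicOn

/-! ### Gates and geodesics through a vertex -/

/-- The vertex `a` is the last one before `c` on some geodesic from `x` to `c`. -/
def IsGate {A : Type*} (Z : SimpleGraph A) (c x a : A) : Prop :=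
  ∃ (q : Z.Walk x a) (h : Z.Adj a c), IsGeodesic (q.concat h)

section IsGate

variable {A : Type*} {Z : SimpleGraph A} {a b c u v x y : A} {δ n : ℕ}

theorem isGate_self (h : Z.Adj a c) : IsGate Z c a a :=
  ⟨.nil, h, isGeodesic_of_adj h⟩

theorem exists_concat_of_ne (p : Z.Walk x c) (hx : x ≠ c) :
    ∃ (a : A) (q : Z.Walk x a) (h : Z.Adj a c), p = q.concat h :=
  have hp : ¬ p.Nil := Walk.not_nil_of_ne hx
  ⟨_, p.dropLast, p.adj_penultimate hp, (p.concat_dropLast (p.adj_penultimate hp)).symm⟩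

theorem exists_isGate (h : Z.Reachable x c) (hx : x ≠ c) : ∃ a, IsGate Z c x a := by
  obtain ⟨p, hp⟩ := h.exists_walk_length_eq_dist
  obtain ⟨a, q, ha, rfl⟩ := exists_concat_of_ne p hx
  exact ⟨a, q, ha, hp⟩

theorem near_off_of_notMem_support {p : Z.Walk x y} (hp : c ∉ p.support) (hn : p.length ≤ n) :
    Near (restr Z {c}ᶜ) n x y :=
  near_restr_of_walk p (fun _ hv hvc ↦ hp (Set.mem_singleton_iff.1 hvc ▸ hv)) hn

theorem Near.off (h : Near Z n x y) (hc : ¬ Near Z n x c) : Near (restr Z {c}ᶜ) n x y := by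
  obtain ⟨p, hp⟩ := h.exists_walk
  exact near_off_of_notMem_support
    (fun hcp ↦ hc ((near_of_mem_support p.start_mem_support hcp).mono hp)) hp

theorem IsGeodesic.near_off {γ : Z.Walk x y} (hγ : IsGeodesic γ) (hc : c ∉ γ.support)
    (hu : u ∈ γ.support) (hv : v ∈ γ.support) (h : Near Z n u v) :
    Near (restr Z {c}ᶜ) n u v := by
  have hle {i j : ℕ} (hij : i ≤ j) (hj : j ≤ γ.length)
      (h : Near Z n (γ.getVert i) (γ.getVert j)) :
      Near (restr Z {c}ᶜ) n (γ.getVert i) (γ.getVert j) := by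
    obtain ⟨q, hqγ, hq⟩ := exists_isSubwalk_getVert γ hij
    have := hγ.le_add_of_near hj h
    exact near_off_of_notMem_support (fun hcq ↦ hc (hqγ.support_subset hcq)) (by omega)
  obtain ⟨i, rfl, hi⟩ := Walk.mem_support_iff_exists_getVert.1 hu
  obtain ⟨j, rfl, hj⟩ := Walk.mem_support_iff_exists_getVert.1 hv
  rcases le_total i j with hij | hij
  · exact hle hij hj h
  · exact (hle hij hi h.symm).symm

theorem notMem_support_of_isGeodesic_concat {q : Z.Walk x a} {h : Z.Adj a c}
    (hq : IsGeodesic (q.concat h)) : c ∉ q.support := by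
  intro hc
  obtain ⟨q₁, q₂, rfl⟩ := Walk.mem_support_iff_exists_append.1 hc
  have := hq.length_le q₁
  simp only [Walk.length_concat, Walk.length_append] at this
  omega

theorem near_off_gate_of_near {q : Z.Walk x a} {h : Z.Adj a c} (hq : IsGeodesic (q.concat h))
    (hv : v ∈ q.support) (hn : Near Z (n + 1) v c) : Near (restr Z {c}ᶜ) n v a := by
  have hc := notMem_support_of_isGeodesic_concat hq
  obtain ⟨q₁, q₂, rfl⟩ := Walk.mem_support_iff_exists_append.1 hv
  obtain ⟨s, hs⟩ := hn.exists_walk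
  have hlen := hq.length_le (q₁.append s)
  simp only [Walk.length_concat, Walk.length_append] at hlen
  rw [Walk.mem_support_append_iff, not_or] at hc
  exact near_off_of_notMem_support hc.2 (by omega)

theorem exists_near_off_gate {q : Z.Walk x a} {h : Z.Adj a c} (hq : IsGeodesic (q.concat h))
    (hn : n ≤ q.length) : ∃ u ∈ q.support, Near (restr Z {c}ᶜ) n u a ∧ ¬ Near Z n u c := by
  have hsub := q.isSubwalk_drop (q.length - n)
  refine ⟨_, hsub.support_subset (Walk.start_mem_support _), near_off_of_notMem_support
    (fun hc ↦ notMem_support_of_isGeodesic_concat hq (hsub.support_subset hc))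
    (by rw [Walk.drop_length]; omega), fun hc ↦ ?_⟩
  obtain ⟨s, hs⟩ := hc.exists_walk
  have := hq.length_le ((q.take (q.length - n)).append s)
  simp only [Walk.length_concat, Walk.length_append, Walk.take_length] at this
  omega

theorem near_gate_or_near_gates (hZ : Slim Z δ) {γ : Z.Walk x y} (hγ : IsGeodesic γ)
    (ha : IsGate Z c x a) (hb : IsGate Z c y b) :
    (∃ g ∈ γ.support, Near (restr Z {c}ᶜ) (2 * δ + 1) a g) ∨
      Near (restr Z {c}ᶜ) (4 * δ + 2) a b := by
  obtain ⟨q, hac, hq⟩ := ha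
  obtain ⟨q', hbc, hq'⟩ := hb
  rcases le_total q.length (δ + 1) with hlen | hlen
  · exact .inl ⟨x, γ.start_mem_support, (near_off_of_notMem_support
      (notMem_support_of_isGeodesic_concat hq) (by omega)).symm⟩
  obtain ⟨u, hu, hua, huc⟩ := exists_near_off_gate hq hlen
  obtain ⟨v, hv, huv⟩ := hZ x c y _ _ _ hq hq'.reverse hγ u
    (by rw [Walk.support_concat]; exact List.mem_append_left _ hu)
  have huv' : Near (restr Z {c}ᶜ) δ u v := huv.off fun h ↦ huc (h.mono (by omega))
  have hav := hua.symm.trans huv'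
  rcases hv with hv | hv
  · rw [Walk.support_reverse, List.mem_reverse, Walk.support_concat, List.mem_append,
      List.mem_singleton] at hv
    rcases hv with hv | rfl
    · have hvc : Near Z (2 * δ + 1 + 1) v c :=
        ((hav.symm.mono_graph restr_le).trans (.of_adj hac)).mono (by omega)
      exact .inr ((hav.trans (near_off_gate_of_near hq' hv hvc)).mono (by omega))
    · exact absurd (huv.mono (by omega)) huc
  · exact .inl ⟨v, hv, hav.mono (by omega)⟩

/-- Bounded geodesic image: a geodesic avoiding `c` joins vertices whose gates at `c` are close in
the complement of `c`. -/
theorem near_gates_of_notMem_support (hZ : Slim Z δ) {γ : Z.Walk x y} (hγ : IsGeodesic γ)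
    (hc : c ∉ γ.support) (ha : IsGate Z c x a) (hb : IsGate Z c y b) :
    Near (restr Z {c}ᶜ) (8 * δ + 6) a b := by
  rcases near_gate_or_near_gates hZ hγ ha hb with ⟨g, hg, hag⟩ | h
  · rcases near_gate_or_near_gates hZ hγ.reverse hb ha with ⟨g', hg', hbg⟩ | h
    · rw [Walk.support_reverse, List.mem_reverse] at hg'
      obtain ⟨-, hac, -⟩ := ha
      obtain ⟨-, hbc, -⟩ := hb
      have hgg' := ((hag.mono_graph restr_le).symm.trans ((Near.of_adj hac).trans
        (.of_adj hbc.symm))).trans (hbg.mono_graph restr_le)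
      exact ((hag.trans (hγ.near_off hc hg hg' hgg')).trans hbg.symm).mono (by omega)
    · exact h.symm.mono (by omega)
  · exact h.mono (by omega)

theorem near_gate_of_edist_le (hZ : Slim Z δ) (hac : a ≠ c) (hn : Near Z 2 a c)
    (hxa : Z.edist x a ≤ Z.edist x c) (hb : IsGate Z c x b) :
    Near (restr Z {c}ᶜ) (8 * δ + 7) b a := by
  obtain ⟨w, hw⟩ := exists_isGate hn.reachable hac
  have haw : Near (restr Z {c}ᶜ) 1 a w := by
    obtain ⟨q, h, hq⟩ := hw
    exact near_off_gate_of_near hq q.start_mem_support hn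
  obtain ⟨q, hbc, -⟩ := id hb
  obtain ⟨σ, hσ⟩ := exists_walk_of_edist_ne_top
    (ne_top_of_le_ne_top (edist_ne_top_iff_reachable.2 (q.concat hbc).reachable) hxa)
  have hcσ : c ∉ σ.support := by
    intro hc
    obtain ⟨σ₁, σ₂, rfl⟩ := Walk.mem_support_iff_exists_append.1 hc
    have hlen : σ₁.length + σ₂.length ≤ σ₁.length := by
      rw [← Walk.length_append, ← Nat.cast_le (α := ℕ∞), hσ]
      exact hxa.trans (Z.edist_le σ₁)
    exact hac (Walk.eq_of_length_eq_zero (p := σ₂) (by omega)).symm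
  have hσ' : IsGeodesic σ := by rw [IsGeodesic, SimpleGraph.dist, ← hσ, ENat.toNat_natCast]
  exact (near_gates_of_notMem_support hZ hσ' hcσ hb hw).trans haw.symm

end IsGate

/-- The vertex `z` lies on some geodesic from `x` to `y`. -/
def IsBetween {A : Type*} (Z : SimpleGraph A) (x y z : A) : Prop :=
  ∃ (p : Z.Walk x z) (q : Z.Walk z y), IsGeodesic (p.append q)

/-- Some geodesic from `x` to `y` passes through `a`, `c`, `b` consecutively. -/
def PassesThrough {A : Type*} (Z : SimpleGraph A) (c a b x y : A) : Prop :=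
  ∃ (p : Z.Walk x a) (h₁ : Z.Adj a c) (h₂ : Z.Adj c b) (q : Z.Walk b y),
    IsGeodesic (p.append (.cons h₁ (.cons h₂ q)))

section IsBetween

variable {A : Type*} {Z : SimpleGraph A} {a b c x y z : A}

theorem IsBetween.symm (h : IsBetween Z x y z) : IsBetween Z y x z := by
  obtain ⟨p, q, h⟩ := h
  exact ⟨q.reverse, p.reverse, by simpa only [Walk.reverse_append] using h.reverse⟩

theorem PassesThrough.symm (h : PassesThrough Z c a b x y) : PassesThrough Z c b a y x := by
  obtain ⟨p, h₁, h₂, q, h⟩ := h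
  refine ⟨q.reverse, h₂.symm, h₁.symm, p.reverse, ?_⟩
  simpa only [Walk.reverse_append, Walk.reverse_cons, ← Walk.append_assoc, Walk.cons_append,
    Walk.nil_append] using h.reverse

theorem PassesThrough.isBetween_left (h : PassesThrough Z c a b x y) : IsBetween Z x y a := by
  obtain ⟨p, h₁, h₂, q, h⟩ := h
  exact ⟨p, _, h⟩

theorem PassesThrough.adj_left (h : PassesThrough Z c a b x y) : Z.Adj a c := by
  obtain ⟨-, hac, -⟩ := h
  exact hac

theorem PassesThrough.exists_avoiding_left (h : PassesThrough Z c a b x y) :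
    ∃ p : Z.Walk x a, IsGeodesic p ∧ c ∉ p.support := by
  obtain ⟨p, h₁, h₂, q, h⟩ := h
  rw [← Walk.concat_append] at h
  exact ⟨p, h.append_left.of_isSubwalk (p.isSubwalk_rfl.concat h₁),
    notMem_support_of_isGeodesic_concat h.append_left⟩

theorem exists_passesThrough {γ : Z.Walk x y} (hγ : IsGeodesic γ) (hc : c ∈ γ.support)
    (hx : x ≠ c) (hy : y ≠ c) : ∃ a b, PassesThrough Z c a b x y := by
  obtain ⟨p, q, rfl⟩ := Walk.mem_support_iff_exists_append.1 hc
  obtain ⟨a, p, h₁, rfl⟩ := exists_concat_of_ne p hx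
  cases q with
  | nil => exact absurd rfl hy
  | cons h₂ q =>
    rw [Walk.concat_append] at hγ
    exact ⟨a, _, p, h₁, h₂, q, hγ⟩

theorem IsBetween.exists_avoiding (h : IsBetween Z x y z) (hz : z ≠ c) :
    (∃ p : Z.Walk x z, IsGeodesic p ∧ c ∉ p.support) ∨
      ∃ q : Z.Walk z y, IsGeodesic q ∧ c ∉ q.support := by
  obtain ⟨p, q, h⟩ := h
  by_cases hp : c ∈ p.support
  · refine .inr ⟨q, h.append_right, fun hq ↦ hz ?_⟩
    obtain ⟨p₁, p₂, rfl⟩ := Walk.mem_support_iff_exists_append.1 hp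
    obtain ⟨q₁, q₂, rfl⟩ := Walk.mem_support_iff_exists_append.1 hq
    have hlen := h.length_le (p₁.append q₂)
    simp only [Walk.length_append] at hlen
    exact Walk.eq_of_length_eq_zero (p := q₁) (by omega)
  · exact .inl ⟨p, h.append_left, hp⟩

end IsBetween

theorem Slim.near_of_near_ends {A : Type*} {H : SimpleGraph A} {δ N : ℕ} (hH : Slim H δ)
    {a e a₁ e₁ : A} {r : H.Walk a e} {r₁ : H.Walk a₁ e₁} (hr : IsGeodesic r) (hr₁ : IsGeodesic r₁)
    (ha : Near H N a a₁) (he : Near H N e e₁) {u : A} (hu : u ∈ r.support) :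
    ∃ v ∈ r₁.support, Near H (2 * δ + N) u v := by
  obtain ⟨s, hs⟩ := he.reachable.exists_walk_length_eq_dist
  obtain ⟨t, ht⟩ := ha.reachable.exists_walk_length_eq_dist
  obtain ⟨d, hd⟩ := (r.append s).reachable.exists_walk_length_eq_dist
  have hsN := IsGeodesic.length_le_of_near hs he
  have htN := IsGeodesic.length_le_of_near ht ha
  obtain ⟨v, hv | hv, huv⟩ := hH _ _ _ r s d hr hs hd u hu
  · exact ⟨e₁, r₁.end_mem_support,
      (huv.trans (near_of_mem_support hv s.end_mem_support)).mono (by omega)⟩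
  · obtain ⟨w, hw | hw, hvw⟩ := hH _ _ _ d r₁.reverse t hd hr₁.reverse ht v hv
    · rw [Walk.support_reverse, List.mem_reverse] at hw
      exact ⟨w, hw, (huv.trans hvw).mono (by omega)⟩
    · exact ⟨a₁, r₁.start_mem_support,
        ((huv.trans hvw).trans (near_of_mem_support hw t.end_mem_support)).mono (by omega)⟩

/-! ### Removing cone vertices from a hyperbolic graph -/

/-- The vertices in `T` are cone points over subgraphs of the graph induced on `S`: the neighbours
of `c ∈ T` lie in a hyperbolic subgraph `B c` that is undistorted in the complement of `c`. -/
structure ConeSystem {A : Type*} (E : SimpleGraph A) (S T : Set A) (B : A → Set A) (δ K : ℕ) :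
    Prop where
  disjoint : Disjoint S T
  hyperbolicOn : HyperbolicOn E (S ∪ T) δ
  cone_subset : ∀ c ∈ T, B c ⊆ S
  mem_cone : ∀ c ∈ T, ∀ v ∈ S ∪ T, E.Adj v c → v ∈ B c
  hyperbolicOn_cone : ∀ c ∈ T, HyperbolicOn E (B c) δ
  undistorted : ∀ c ∈ T, ∀ a ∈ B c, ∀ b ∈ B c, ∀ m,
    Near (restr E ((S ∪ T) \ {c})) m a b → Near (restr E (B c)) (K * (m + 1)) a b

/-- The de-electrifications of the geodesics from `x` to `y` in the graph induced on `S ∪ T`: their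
vertices in `S`, and the vertices of the geodesics of the subgraphs `B c` that replace the passages
through `c ∈ T`. -/
def deelectrified {A : Type*} (E : SimpleGraph A) (S T : Set A) (B : A → Set A) (x y : A) :
    Set A :=
  {z | (z ∈ S ∧ IsBetween (restr E (S ∪ T)) x y z) ∨
    ∃ c ∈ T, ∃ a b, PassesThrough (restr E (S ∪ T)) c a b x y ∧
      ∃ r : (restr E (B c)).Walk a b, IsGeodesic r ∧ z ∈ r.support}

/-- The constant in the bounded geodesic image property of the cones. -/
def imageConst (δ K : ℕ) : ℕ := K * (8 * δ + 6 + 1)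

/-- The slimness constant for the vertices in `S` of geodesics of the coned-off graph. -/
def betweenConst (δ K : ℕ) : ℕ := (6 * imageConst δ K + 1) * (δ + 1) + 4 * imageConst δ K

/-- The slimness constant of the de-electrified geodesics. -/
def guessConst (δ K : ℕ) : ℕ := 3 * δ + 2 * imageConst δ K + betweenConst δ K + 1

theorem deelectrified_symm {A : Type*} {E : SimpleGraph A} {S T : Set A} {B : A → Set A}
    {x y z : A} (h : z ∈ deelectrified E S T B x y) : z ∈ deelectrified E S T B y x := by
  rcases h with ⟨hz, h⟩ | ⟨c, hc, a, b, h, r, hr, hz⟩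
  · exact .inl ⟨hz, h.symm⟩
  · refine .inr ⟨c, hc, b, a, h.symm, r.reverse, hr.reverse, ?_⟩
    rwa [Walk.support_reverse, List.mem_reverse]

namespace ConeSystem

variable {A : Type*} {E : SimpleGraph A} {S T : Set A} {B : A → Set A} {δ K n : ℕ}
  {a b c a' b' u v w x y z z' : A}

theorem mem_cone_of_adj (h : ConeSystem E S T B δ K) (hc : c ∈ T)
    (ha : (restr E (S ∪ T)).Adj a c) : a ∈ B c :=
  h.mem_cone c hc a ha.1 ha.2.2

theorem mem_of_adj (h : ConeSystem E S T B δ K) (hc : c ∈ T)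
    (ha : (restr E (S ∪ T)).Adj a c) : a ∈ S :=
  h.cone_subset c hc (h.mem_cone_of_adj hc ha)

theorem notMem (h : ConeSystem E S T B δ K) (hc : c ∈ T) : c ∉ S :=
  Set.disjoint_right.1 h.disjoint hc

theorem ne_of_mem (h : ConeSystem E S T B δ K) (hc : c ∈ T) (hx : x ∈ S) : x ≠ c :=
  fun e ↦ h.notMem hc (e ▸ hx)

theorem near_of_near_cone (h : ConeSystem E S T B δ K) (hc : c ∈ T)
    (hab : Near (restr E (B c)) n a b) : Near (restr E S) n a b :=
  hab.mono_graph (restr_mono (h.cone_subset c hc))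

theorem exists_isGeodesic (h : ConeSystem E S T B δ K) (hx : x ∈ S) (hy : y ∈ S) :
    ∃ γ : (restr E (S ∪ T)).Walk x y, IsGeodesic γ :=
  h.hyperbolicOn.exists_isGeodesic (.inl hx) (.inl hy)

theorem exists_isGeodesic_cone (h : ConeSystem E S T B δ K) (hc : c ∈ T)
    (ha : (restr E (S ∪ T)).Adj a c) (hb : (restr E (S ∪ T)).Adj b c) :
    ∃ r : (restr E (B c)).Walk a b, IsGeodesic r :=
  (h.hyperbolicOn_cone c hc).exists_isGeodesic (h.mem_cone_of_adj hc ha) (h.mem_cone_of_adj hc hb)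

theorem exists_isGate (h : ConeSystem E S T B δ K) (hc : c ∈ T) (hx : x ∈ S) :
    ∃ a, IsGate (restr E (S ∪ T)) c x a :=
  CHHF.exists_isGate (h.hyperbolicOn.reachable (.inl hx) (.inr hc)) (h.ne_of_mem hc hx)

theorem near_gates (h : ConeSystem E S T B δ K) (hc : c ∈ T)
    {γ : (restr E (S ∪ T)).Walk x y} (hγ : IsGeodesic γ) (hcγ : c ∉ γ.support)
    (ha : IsGate (restr E (S ∪ T)) c x a) (hb : IsGate (restr E (S ∪ T)) c y b) :
    Near (restr E (B c)) (imageConst δ K) a b := by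
  have hab := near_gates_of_notMem_support h.hyperbolicOn.slim hγ hcγ ha hb
  rw [restr_restr, ← Set.sdiff_eq] at hab
  obtain ⟨-, hac, -⟩ := ha
  obtain ⟨-, hbc, -⟩ := hb
  exact h.undistorted c hc a (h.mem_cone_of_adj hc hac) b (h.mem_cone_of_adj hc hbc) _ hab

theorem near_gate_of_passesThrough (h : ConeSystem E S T B δ K) (hc : c ∈ T)
    (hp : PassesThrough (restr E (S ∪ T)) c a b x y) (ha' : IsGate (restr E (S ∪ T)) c x a') :
    Near (restr E (B c)) (imageConst δ K) a' a := by
  obtain ⟨p, hpx, hcp⟩ := hp.exists_avoiding_left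
  exact h.near_gates hc hpx hcp ha' (isGate_self hp.adj_left)

theorem exists_passesThrough (h : ConeSystem E S T B δ K) (hc : c ∈ T) (hx : x ∈ S)
    (hy : y ∈ S) (ha' : IsGate (restr E (S ∪ T)) c x a') (hb' : IsGate (restr E (S ∪ T)) c y b')
    (hfar : ¬ Near (restr E (B c)) (imageConst δ K) a' b') :
    ∃ a b, PassesThrough (restr E (S ∪ T)) c a b x y := by
  obtain ⟨γ, hγ⟩ := h.exists_isGeodesic hx hy
  have hcγ : c ∈ γ.support := not_not.1 fun hcγ ↦ hfar (h.near_gates hc hγ hcγ ha' hb')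
  exact CHHF.exists_passesThrough hγ hcγ (h.ne_of_mem hc hx) (h.ne_of_mem hc hy)

theorem near_gate_of_isBetween (h : ConeSystem E S T B δ K) (hc : c ∈ T)
    (hz : z ∈ S) (hb : IsBetween (restr E (S ∪ T)) x y z) (ha' : IsGate (restr E (S ∪ T)) c x a')
    (hb' : IsGate (restr E (S ∪ T)) c y b') (hz' : IsGate (restr E (S ∪ T)) c z z') :
    Near (restr E (B c)) (imageConst δ K) z' a' ∨
      Near (restr E (B c)) (imageConst δ K) z' b' := by
  rcases hb.exists_avoiding (h.ne_of_mem hc hz) with ⟨p, hp, hcp⟩ | ⟨q, hq, hcq⟩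
  · exact .inl (h.near_gates hc hp hcp ha' hz').symm
  · exact .inr (h.near_gates hc hq hcq hz' hb')

theorem deelectrified_subset (h : ConeSystem E S T B δ K) : deelectrified E S T B x y ⊆ S := by
  rintro z (⟨hz, -⟩ | ⟨c, hc, a, b, hp, r, -, hz⟩)
  · exact hz
  · exact h.cone_subset c hc
      (mem_of_mem_support_restr (h.mem_cone_of_adj hc hp.adj_left) r z hz)

theorem mem_deelectrified_of_passesThrough (h : ConeSystem E S T B δ K) (hc : c ∈ T)
    (hp : PassesThrough (restr E (S ∪ T)) c a b x y) : a ∈ deelectrified E S T B x y :=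
  .inl ⟨h.mem_of_adj hc hp.adj_left, hp.isBetween_left⟩

/-- Since cone points are pairwise non-adjacent, a walk between vertices of `S` is a sequence of
edges in `S` and of passages through single cone points. -/
@[elab_as_elim]
theorem walk_induction (h : ConeSystem E S T B δ K) (hy : y ∈ S)
    {motive : ∀ z, (restr E (S ∪ T)).Walk z y → Prop} (nil : motive y .nil)
    (edge : ∀ z v (hzv : (restr E (S ∪ T)).Adj z v) (σ : (restr E (S ∪ T)).Walk v y),
      z ∈ S → v ∈ S → motive v σ → motive z (.cons hzv σ))
    (cone : ∀ z c b (hzc : (restr E (S ∪ T)).Adj z c) (hcb : (restr E (S ∪ T)).Adj c b)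
      (σ : (restr E (S ∪ T)).Walk b y),
      c ∈ T → motive b σ → motive z (.cons hzc (.cons hcb σ)))
    (hz : z ∈ S) (σ : (restr E (S ∪ T)).Walk z y) : motive z σ := by
  induction hn : σ.length using Nat.strong_induction_on generalizing z with
  | _ n ih =>
    subst hn
    cases σ with
    | nil => exact nil
    | @cons _ v _ hzv σ =>
      rcases hzv.2.1 with hv | hv
      · exact edge z v hzv σ hz hv (ih _ (by simp) hv σ rfl)
      · cases σ with
        | nil => exact absurd hy (h.notMem hv)
        | @cons _ b _ hvb σ =>
          exact cone z v b hzv hvb σ hv (ih _ (by simp) (h.mem_of_adj hv hvb.symm) σ rfl)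

theorem near_or_exists_jump (h : ConeSystem E S T B δ K) {M : ℕ} (hM : 1 ≤ M) (hz : z ∈ S)
    (hz' : z' ∈ S) (σ : (restr E (S ∪ T)).Walk z z') :
    Near (restr E S) (M * σ.length) z z' ∨
      ∃ c ∈ T, ∃ (a b : A) (p : (restr E (S ∪ T)).Walk z a) (h₁ : (restr E (S ∪ T)).Adj a c)
        (h₂ : (restr E (S ∪ T)).Adj c b) (q : (restr E (S ∪ T)).Walk b z'),
        σ = p.append (.cons h₁ (.cons h₂ q)) ∧ Near (restr E S) (M * σ.length) z a ∧
        ¬ Near (restr E (B c)) M a b := by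
  refine h.walk_induction hz' ?nil ?edge ?cone hz σ
  case nil => exact .inl (.refl _ _ _)
  case edge =>
    intro z v hzv σ hz hv ih
    have hM' : M + M * σ.length ≤ M * (σ.length + 1) := by linarith
    have hn : Near (restr E S) M z v := (Near.of_adj (H := restr E S) ⟨hz, hv, hzv.2.2⟩).mono hM
    rw [Walk.length_cons]
    rcases ih with ih | ⟨c, hc, a, b, p, h₁, h₂, q, hσ, hva, hfar⟩
    · exact .inl ((hn.trans ih).mono hM')
    · exact .inr ⟨c, hc, a, b, .cons hzv p, h₁, h₂, q, by rw [hσ, Walk.cons_append],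
        (hn.trans hva).mono hM', hfar⟩
  case cone =>
    intro z c b hzc hcb σ hc ih
    by_cases hn : Near (restr E (B c)) M z b
    · have hM' : M + M * σ.length ≤ M * (σ.length + 1 + 1) := by linarith
      have hn' := h.near_of_near_cone hc hn
      rw [Walk.length_cons, Walk.length_cons]
      rcases ih with ih | ⟨c', hc', a, b', p, h₁, h₂, q, hσ, hba, hfar⟩
      · exact .inl ((hn'.trans ih).mono hM')
      · exact .inr ⟨c', hc', a, b', .cons hzc (.cons hcb p), h₁, h₂, q,
          by rw [hσ, Walk.cons_append, Walk.cons_append], (hn'.trans hba).mono hM', hfar⟩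
    · exact .inr ⟨c, hc, z, b, .nil, hzc, hcb, σ, rfl, .refl _ _ _, hn⟩

theorem near_or_exists_passesThrough (h : ConeSystem E S T B δ K) {M : ℕ} (hM : 1 ≤ M)
    (hz : z ∈ S) (hz' : z' ∈ S) (hn : Near (restr E (S ∪ T)) n z z') :
    Near (restr E S) (M * n) z z' ∨
      ∃ c ∈ T, ∃ a b, PassesThrough (restr E (S ∪ T)) c a b z z' ∧
        Near (restr E S) (M * n) z a ∧ ¬ Near (restr E (B c)) M a b := by
  obtain ⟨σ, hσ⟩ := h.exists_isGeodesic hz hz'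
  have hlen : M * σ.length ≤ M * n := Nat.mul_le_mul_left M (hσ.length_le_of_near hn)
  rcases h.near_or_exists_jump hM hz hz' σ with
    hzz' | ⟨c, hc, a, b, p, h₁, h₂, q, rfl, hza, hfar⟩
  · exact .inl (hzz'.mono hlen)
  · exact .inr ⟨c, hc, a, b, ⟨p, h₁, h₂, q, hσ⟩, hza.mono hlen, hfar⟩

theorem exists_near_deelectrified_of_far_gates (h : ConeSystem E S T B δ K) {s t ps pt p : A}
    (hc : c ∈ T) (hs : s ∈ S) (ht : t ∈ S) (hps : IsGate (restr E (S ∪ T)) c s ps)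
    (hpt : IsGate (restr E (S ∪ T)) c t pt)
    (hfar : ¬ Near (restr E (B c)) (imageConst δ K) ps pt)
    (hp : Near (restr E (B c)) (2 * imageConst δ K) p ps) :
    ∃ v ∈ deelectrified E S T B s t, Near (restr E (B c)) (3 * imageConst δ K) p v := by
  obtain ⟨a, b, hab⟩ := h.exists_passesThrough hc hs ht hps hpt hfar
  exact ⟨a, h.mem_deelectrified_of_passesThrough hc hab,
    (hp.trans (h.near_gate_of_passesThrough hc hab hps)).mono (by omega)⟩

theorem near_gates_or_near_deelectrified_of_near_left (h : ConeSystem E S T B δ K)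
    {px py pw p : A} (hc : c ∈ T) (hx : x ∈ S) (hy : y ∈ S) (hw : w ∈ S)
    (hpx : IsGate (restr E (S ∪ T)) c x px) (hpy : IsGate (restr E (S ∪ T)) c y py)
    (hpw : IsGate (restr E (S ∪ T)) c w pw)
    (hp : Near (restr E (B c)) (imageConst δ K) p px) :
    (Near (restr E (B c)) (imageConst δ K) px pw ∧
      Near (restr E (B c)) (imageConst δ K) py pw) ∨
      ∃ v, (v ∈ deelectrified E S T B x w ∨ v ∈ deelectrified E S T B w y) ∧
        Near (restr E (B c)) (3 * imageConst δ K) p v := by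
  by_cases hxw : Near (restr E (B c)) (imageConst δ K) px pw
  · by_cases hwy : Near (restr E (B c)) (imageConst δ K) pw py
    · exact .inl ⟨hxw, hwy.symm⟩
    · obtain ⟨v, hv, hpv⟩ := h.exists_near_deelectrified_of_far_gates hc hw hy hpw hpy hwy
        ((hp.trans hxw).mono (by omega))
      exact .inr ⟨v, .inr hv, hpv⟩
  · obtain ⟨v, hv, hpv⟩ := h.exists_near_deelectrified_of_far_gates hc hx hw hpx hpw hxw
      (hp.mono (by omega))
    exact .inr ⟨v, .inl hv, hpv⟩

theorem near_gates_or_near_deelectrified (h : ConeSystem E S T B δ K) {px py pw p : A}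
    (hc : c ∈ T) (hx : x ∈ S) (hy : y ∈ S) (hw : w ∈ S)
    (hpx : IsGate (restr E (S ∪ T)) c x px) (hpy : IsGate (restr E (S ∪ T)) c y py)
    (hpw : IsGate (restr E (S ∪ T)) c w pw)
    (hp : Near (restr E (B c)) (imageConst δ K) p px ∨
      Near (restr E (B c)) (imageConst δ K) p py) :
    (Near (restr E (B c)) (imageConst δ K) px pw ∧
      Near (restr E (B c)) (imageConst δ K) py pw) ∨
      ∃ v, (v ∈ deelectrified E S T B x w ∨ v ∈ deelectrified E S T B w y) ∧
        Near (restr E (B c)) (3 * imageConst δ K) p v := by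
  rcases hp with hp | hp
  · exact h.near_gates_or_near_deelectrified_of_near_left hc hx hy hw hpx hpy hpw hp
  · rcases h.near_gates_or_near_deelectrified_of_near_left hc hy hx hw hpy hpx hpw hp with
      ⟨hy, hx⟩ | ⟨v, hv, hpv⟩
    · exact .inl ⟨hx, hy⟩
    · exact .inr ⟨v, hv.symm.imp deelectrified_symm deelectrified_symm, hpv⟩

theorem near_gate_of_isBetween_of_near_gates (h : ConeSystem E S T B δ K) {px py pw pz : A}
    (hc : c ∈ T) (hz : z ∈ S)
    (hpx : IsGate (restr E (S ∪ T)) c x px) (hpy : IsGate (restr E (S ∪ T)) c y py)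
    (hpz : IsGate (restr E (S ∪ T)) c z pz) (hb : IsBetween (restr E (S ∪ T)) x y z)
    (hxw : Near (restr E (B c)) (imageConst δ K) px pw)
    (hyw : Near (restr E (B c)) (imageConst δ K) py pw) :
    Near (restr E (B c)) (2 * imageConst δ K) pz pw := by
  rw [two_mul]
  rcases h.near_gate_of_isBetween hc hz hb hpx hpy hpz with hn | hn
  · exact hn.trans hxw
  · exact hn.trans hyw

theorem near_deelectrified_of_near_isBetween (h : ConeSystem E S T B δ K) (hx : x ∈ S)
    (hy : y ∈ S) (hw : w ∈ S) (hz : z ∈ S) (hxyz : IsBetween (restr E (S ∪ T)) x y z)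
    (hz' : z' ∈ S) (hb : IsBetween (restr E (S ∪ T)) x w z' ∨ IsBetween (restr E (S ∪ T)) w y z')
    (hn : Near (restr E (S ∪ T)) n z z') :
    ∃ v, (v ∈ deelectrified E S T B x w ∨ v ∈ deelectrified E S T B w y) ∧
      Near (restr E S) ((6 * imageConst δ K + 1) * n + 4 * imageConst δ K) z v := by
  rcases h.near_or_exists_passesThrough (M := 6 * imageConst δ K + 1) (by omega) hz hz' hn with
    hzz' | ⟨c, hc, a, b, hab, hza, hfar⟩
  · exact ⟨z', hb.imp (.inl ⟨hz', ·⟩) (.inl ⟨hz', ·⟩), hzz'.mono (by omega)⟩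
  obtain ⟨px, hpx⟩ := h.exists_isGate hc hx
  obtain ⟨py, hpy⟩ := h.exists_isGate hc hy
  obtain ⟨pw, hpw⟩ := h.exists_isGate hc hw
  obtain ⟨pz, hpz⟩ := h.exists_isGate hc hz
  obtain ⟨pz', hpz'⟩ := h.exists_isGate hc hz'
  have hpza := h.near_gate_of_passesThrough hc hab hpz
  rcases h.near_gates_or_near_deelectrified hc hx hy hw hpx hpy hpw
    (h.near_gate_of_isBetween hc hz hxyz hpx hpy hpz) with ⟨hxw, hyw⟩ | ⟨v, hv, hpzv⟩
  · have hzw := h.near_gate_of_isBetween_of_near_gates hc hz hpx hpy hpz hxyz hxw hyw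
    have hzw' : Near (restr E (B c)) (2 * imageConst δ K) pz' pw := by
      have hww : Near (restr E (B c)) (imageConst δ K) pw pw := (Near.refl _ _ _)
      rcases hb with hb | hb
      · exact h.near_gate_of_isBetween_of_near_gates hc hz' hpx hpw hpz' hb hxw hww
      · exact h.near_gate_of_isBetween_of_near_gates hc hz' hpw hpy hpz' hb hww hyw
    have hpzb := h.near_gate_of_passesThrough hc hab.symm hpz'
    exact absurd ((((hpza.symm.trans hzw).trans hzw'.symm).trans hpzb).mono (by omega)) hfar
  · exact ⟨v, hv, (hza.trans (h.near_of_near_cone hc (hpza.symm.trans hpzv))).mono (by omega)⟩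

theorem exists_isBetween_near (h : ConeSystem E S T B δ K) (hx : x ∈ S)
    {γ : (restr E (S ∪ T)).Walk x y} (hγ : IsGeodesic γ) (hv : v ∈ γ.support) :
    ∃ z ∈ S, IsBetween (restr E (S ∪ T)) x y z ∧ Near (restr E (S ∪ T)) 1 v z := by
  have hvST := mem_of_mem_support_restr (.inl hx) γ v hv
  obtain ⟨p, q, rfl⟩ := Walk.mem_support_iff_exists_append.1 hv
  rcases hvST with hvS | hvT
  · exact ⟨v, hvS, ⟨p, q, hγ⟩, .refl _ _ _⟩
  · obtain ⟨a, p, hav, rfl⟩ := exists_concat_of_ne p (h.ne_of_mem hvT hx)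
    rw [Walk.concat_append] at hγ
    exact ⟨a, h.mem_of_adj hvT hav, ⟨p, _, hγ⟩, .of_adj hav.symm⟩

theorem near_deelectrified_of_isBetween (h : ConeSystem E S T B δ K) (hx : x ∈ S)
    (hy : y ∈ S) (hw : w ∈ S) (hz : z ∈ S) (hxyz : IsBetween (restr E (S ∪ T)) x y z) :
    ∃ v, (v ∈ deelectrified E S T B x w ∨ v ∈ deelectrified E S T B w y) ∧
      Near (restr E S) (betweenConst δ K) z v := by
  obtain ⟨γ₁, hγ₁⟩ := h.exists_isGeodesic hx hw
  obtain ⟨γ₂, hγ₂⟩ := h.exists_isGeodesic hy hw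
  obtain ⟨p, q, hpq⟩ := id hxyz
  obtain ⟨v, hv, hzv⟩ := h.hyperbolicOn.slim x y w _ γ₂ γ₁ hpq hγ₂ hγ₁ z
    ((Walk.mem_support_append_iff _ _).2 (.inl p.end_mem_support))
  obtain ⟨z', hz', hb, hvz'⟩ : ∃ z' ∈ S, (IsBetween (restr E (S ∪ T)) x w z' ∨
      IsBetween (restr E (S ∪ T)) w y z') ∧ Near (restr E (S ∪ T)) 1 v z' := by
    rcases hv with hv | hv
    · obtain ⟨z', hz', hb, hn⟩ := h.exists_isBetween_near hy hγ₂ hv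
      exact ⟨z', hz', .inr hb.symm, hn⟩
    · obtain ⟨z', hz', hb, hn⟩ := h.exists_isBetween_near hx hγ₁ hv
      exact ⟨z', hz', .inl hb, hn⟩
  exact h.near_deelectrified_of_near_isBetween hx hy hw hz hxyz hz' hb (hzv.trans hvz')

theorem near_side_of_cone (h : ConeSystem E S T B δ K) {ps pw : A} (hc : c ∈ T)
    (hx : x ∈ S) (hw : w ∈ S) (hpx : IsGate (restr E (S ∪ T)) c x ps)
    (hpw : IsGate (restr E (S ∪ T)) c w pw)
    (ha : Near (restr E (B c)) (imageConst δ K) ps a) {r : (restr E (B c)).Walk a pw}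
    (hr : IsGeodesic r) (hv : v ∈ r.support) :
    Near (restr E (B c)) (2 * imageConst δ K) v a ∨
      ∃ u ∈ deelectrified E S T B x w,
        Near (restr E (B c)) (2 * δ + 2 * imageConst δ K) v u := by
  by_cases hfar : Near (restr E (B c)) (imageConst δ K) ps pw
  · have hlen := hr.length_le_of_near (ha.symm.trans hfar)
    exact .inl ((near_of_mem_support hv r.start_mem_support).mono (by omega))
  · obtain ⟨a₁, b₁, hab⟩ := h.exists_passesThrough hc hx hw hpx hpw hfar
    have ha₁ := h.near_gate_of_passesThrough hc hab hpx
    have hb₁ := h.near_gate_of_passesThrough hc hab.symm hpw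
    obtain ⟨r₁, hr₁⟩ := h.exists_isGeodesic_cone hc hab.adj_left hab.symm.adj_left
    have haa₁ : Near (restr E (B c)) (2 * imageConst δ K) a a₁ :=
      (ha.symm.trans ha₁).mono (by omega)
    obtain ⟨u, hu, hvu⟩ := (h.hyperbolicOn_cone c hc).slim.near_of_near_ends hr hr₁ haa₁
      (hb₁.mono (by omega)) hv
    exact .inr ⟨u, .inr ⟨c, hc, a₁, b₁, hab, r₁, hr₁, hu⟩, hvu⟩

theorem near_deelectrified_of_mem_support (h : ConeSystem E S T B δ K) {pw : A} (hc : c ∈ T)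
    (hx : x ∈ S) (hy : y ∈ S) (hw : w ∈ S) (hab : PassesThrough (restr E (S ∪ T)) c a b x y)
    (hpw : IsGate (restr E (S ∪ T)) c w pw) {r : (restr E (B c)).Walk a pw}
    (hr : IsGeodesic r) (hv : v ∈ r.support) :
    ∃ u, (u ∈ deelectrified E S T B x w ∨ u ∈ deelectrified E S T B w y) ∧
      Near (restr E S) (2 * δ + 2 * imageConst δ K + betweenConst δ K) v u := by
  obtain ⟨px, hpx⟩ := h.exists_isGate hc hx
  rcases h.near_side_of_cone hc hx hw hpx hpw (h.near_gate_of_passesThrough hc hab hpx) hr hv with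
    hva | ⟨u, hu, hvu⟩
  · obtain ⟨u, hu, hau⟩ := h.near_deelectrified_of_isBetween hx hy hw
      (h.mem_of_adj hc hab.adj_left) hab.isBetween_left
    exact ⟨u, hu, ((h.near_of_near_cone hc hva).trans hau).mono (by omega)⟩
  · exact ⟨u, .inl hu, (h.near_of_near_cone hc hvu).mono (by omega)⟩

theorem deelectrified_thin (h : ConeSystem E S T B δ K) (hx : x ∈ S) (hy : y ∈ S) (hw : w ∈ S)
    (hz : z ∈ deelectrified E S T B x y) :
    ∃ v, (v ∈ deelectrified E S T B x w ∨ v ∈ deelectrified E S T B w y) ∧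
      Near (restr E S) (guessConst δ K) z v := by
  unfold guessConst
  rcases hz with ⟨hz, hb⟩ | ⟨c, hc, a, b, hab, r, hr, hz⟩
  · obtain ⟨v, hv, hn⟩ := h.near_deelectrified_of_isBetween hx hy hw hz hb
    exact ⟨v, hv, hn.mono (by omega)⟩
  obtain ⟨pw, hpw⟩ := h.exists_isGate hc hw
  have hpwc : (restr E (S ∪ T)).Adj pw c := by
    obtain ⟨-, hpwc, -⟩ := hpw
    exact hpwc
  obtain ⟨r₁, hr₁⟩ := h.exists_isGeodesic_cone hc hab.adj_left hpwc
  obtain ⟨r₂, hr₂⟩ := h.exists_isGeodesic_cone hc hab.symm.adj_left hpwc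
  obtain ⟨v, hv, hzv⟩ := (h.hyperbolicOn_cone c hc).slim a b pw r r₂ r₁ hr hr₂ hr₁ z hz
  have hzv' := h.near_of_near_cone hc hzv
  rcases hv with hv | hv
  · obtain ⟨u, hu, hvu⟩ := h.near_deelectrified_of_mem_support hc hy hx hw hab.symm hpw hr₂ hv
    exact ⟨u, hu.symm.imp deelectrified_symm deelectrified_symm,
      (hzv'.trans hvu).mono (by omega)⟩
  · obtain ⟨u, hu, hvu⟩ := h.near_deelectrified_of_mem_support hc hx hy hw hab hpw hr₁ hv
    exact ⟨u, hu, (hzv'.trans hvu).mono (by omega)⟩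

end ConeSystem

theorem deelectrified_small {A : Type*} {E : SimpleGraph A} {S T : Set A} {B : A → Set A}
    {x y z : A} (hxy : Near (restr E S) 1 x y) (hz : z ∈ deelectrified E S T B x y) :
    Near (restr E S) 1 z x := by
  have hxy' := hxy.mono_graph (restr_mono (E := E) (Set.subset_union_left (t := T)))
  rcases hz with ⟨-, p, q, hpq⟩ | ⟨c, -, a, b, ⟨p, h₁, h₂, q, hpq⟩, -⟩
  · have hlen := hpq.length_le_of_near hxy'
    rw [Walk.length_append] at hlen
    obtain hp | hq : p.length = 0 ∨ q.length = 0 := by omega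
    · exact .of_eq (Walk.eq_of_length_eq_zero hp).symm
    · exact Walk.eq_of_length_eq_zero hq ▸ hxy.symm
  · have hlen := hpq.length_le_of_near hxy'
    simp only [Walk.length_append, Walk.length_cons] at hlen
    omega

namespace ConeSystem

variable {A : Type*} {E : SimpleGraph A} {S T : Set A} {B : A → Set A} {δ K : ℕ} {x y z : A}

theorem exists_near_of_isGeodesic_append (h : ConeSystem E S T B δ K) {P : Set A} (hyP : y ∉ P)
    (hy : y ∈ S) (hz : z ∈ S) (hzP : z ∈ P) (p : (restr E (S ∪ T)).Walk x z)
    (σ : (restr E (S ∪ T)).Walk z y) (hσ : IsGeodesic (p.append σ)) :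
    ∃ u ∈ deelectrified E S T B x y, ∃ v ∈ deelectrified E S T B x y,
      u ∈ P ∧ v ∉ P ∧ Near (restr E S) 1 u v := by
  revert p hzP
  refine h.walk_induction hy ?nil ?edge ?cone hz σ
  case nil => exact fun hyP' ↦ absurd hyP' hyP
  case edge =>
    intro z v hzv σ hz hv ih hzP p hσ
    have hσ' : IsGeodesic ((p.concat hzv).append σ) := by rwa [Walk.concat_append]
    by_cases hvP : v ∈ P
    · exact ih hvP _ hσ'
    · exact ⟨z, .inl ⟨hz, p, _, hσ⟩, v, .inl ⟨hv, _, _, hσ'⟩, hzP, hvP,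
        .of_adj ⟨hz, hv, hzv.2.2⟩⟩
  case cone =>
    intro z c b hzc hcb σ hc ih hzP p hσ
    by_cases hbP : b ∈ P
    · exact ih hbP ((p.concat hzc).concat hcb) (by rwa [Walk.concat_append, Walk.concat_append])
    · obtain ⟨r, hr⟩ := h.exists_isGeodesic_cone hc hzc hcb.symm
      obtain ⟨u, hu, w, hw, huw, huP, hwP⟩ := exists_adj_of_walk r P hzP hbP
      have hzb : PassesThrough (restr E (S ∪ T)) c z b x y := ⟨p, hzc, hcb, σ, hσ⟩
      exact ⟨u, .inr ⟨c, hc, z, b, hzb, r, hr, hu⟩, w, .inr ⟨c, hc, z, b, hzb, r, hr, hw⟩,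
        huP, hwP, h.near_of_near_cone hc (.of_adj huw)⟩

theorem deelectrified_cut (h : ConeSystem E S T B δ K) {P : Set A} (hx : x ∈ S) (hy : y ∈ S)
    (hxP : x ∈ P) (hyP : y ∉ P) :
    ∃ u ∈ deelectrified E S T B x y, ∃ v ∈ deelectrified E S T B x y,
      u ∈ P ∧ v ∉ P ∧ Near (restr E S) 1 u v := by
  obtain ⟨γ, hγ⟩ := h.exists_isGeodesic hx hy
  exact h.exists_near_of_isGeodesic_append hyP hy hx hxP .nil γ hγ

theorem right_mem_deelectrified (h : ConeSystem E S T B δ K) (hx : x ∈ S) (hy : y ∈ S) :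
    y ∈ deelectrified E S T B x y := by
  obtain ⟨γ, hγ⟩ := h.exists_isGeodesic hx hy
  exact .inl ⟨hy, γ, .nil, by rwa [Walk.append_nil]⟩

theorem guessFamily (h : ConeSystem E S T B δ K) :
    GuessFamily (E.induce S) (fun x y ↦ Subtype.val ⁻¹' deelectrified E S T B x y)
      (guessConst δ K) := by
  have h1 : 1 ≤ guessConst δ K := Nat.le_add_left 1 _
  refine ⟨?thin, ?small, ?cut, ?right_mem⟩
  case thin =>
    intro x y z u hu
    obtain ⟨v, hv, huv⟩ := h.deelectrified_thin x.2 y.2 z.2 hu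
    have hvS : v ∈ S := hv.elim (h.deelectrified_subset ·) (h.deelectrified_subset ·)
    exact ⟨⟨v, hvS⟩, hv, near_restr_iff.1 huv⟩
  case small =>
    exact fun x y hxy u hu ↦
      near_restr_iff.1 ((deelectrified_small (near_restr_iff.2 hxy) hu).mono h1)
  case cut =>
    intro x y P hx hy
    obtain ⟨u, hu, v, hv, huP, hvP, huv⟩ := h.deelectrified_cut (P := Subtype.val '' P) x.2 y.2
      (Set.mem_image_of_mem _ hx) (by rwa [Subtype.val_injective.mem_set_image])
    exact ⟨⟨u, h.deelectrified_subset hu⟩, hu, ⟨v, h.deelectrified_subset hv⟩, hv,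
      Subtype.val_injective.mem_set_image.1 huP, fun hv' ↦ hvP ⟨_, hv', rfl⟩,
      near_restr_iff.1 (huv.mono h1)⟩
  case right_mem => exact fun x y ↦ h.right_mem_deelectrified x.2 y.2

theorem hyperbolicOn_base (h : ConeSystem E S T B δ K) :
    HyperbolicOn E S (64 * (guessConst δ K + 1) ^ 2 + 2 * guessConst δ K) :=
  h.guessFamily.hyperbolicOn

end ConeSystem

/-! ### Removing the link of a domain -/

theorem IsGraphFactorSystem.exists_rank {V : Type*} {G : SimpleGraph V} {𝔉 : Set (Set V)} {n : ℕ}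
    (h : IsGraphFactorSystem G 𝔉 n) :
    ∃ r : Set V → ℕ, (∀ H ∈ 𝔉, r H < n) ∧ StrictMonoOn r 𝔉 := by
  classical
  have hn : 0 < n := h.chain_lt 0 Fin.elim0 (fun i ↦ i.elim0) (fun i ↦ i.elim0)
  have hle (H : 𝔉) : Order.height H ≤ (n - 1 : ℕ) := by
    refine Order.height_le fun p _ ↦ ?_
    have hp := h.chain_lt _ (fun i ↦ (p i).1) (fun i ↦ (p i).2) p.strictMono
    exact_mod_cast Nat.le_sub_one_of_lt (Nat.lt_of_succ_lt hp)
  have hfin (H : 𝔉) : Order.height H < ⊤ := (hle H).trans_lt (ENat.natCast_lt_top _)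
  refine ⟨fun H ↦ if hH : H ∈ 𝔉 then (Order.height (⟨H, hH⟩ : 𝔉)).toNat else 0, ?_, ?_⟩
  · intro H hH
    simp only [hH, ↓reduceDIte]
    have := ENat.toNat_le_of_le_natCast (hle ⟨H, hH⟩)
    omega
  · intro H hH K hK hHK
    simp only [hH, hK, ↓reduceDIte]
    have hlt := Order.height_strictMono (x := (⟨H, hH⟩ : 𝔉)) (y := ⟨K, hK⟩) hHK (hfin _)
    rwa [← ENat.natCast_toNat (hfin ⟨H, hH⟩).ne, ← ENat.natCast_toNat (hfin ⟨K, hK⟩).ne,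
      ENat.natCast_lt_natCast] at hlt

/-- The part of the hierarchy condition that is needed here: the augmented graph of a domain `H`
is determined by some `H`-graph. -/
def IsIntrinsic {V : Type*} (G : SimpleGraph V) (𝔉 : Set (Set V))
    (W : SimpleGraph (MaxClique G Set.univ)) : Prop :=
  ∀ H ∈ 𝔉, ∃ W' : SimpleGraph (MaxClique G H), augGraph G 𝔉 H W' H = augGraph G 𝔉 Set.univ W H

theorem HierarchyCondition.isIntrinsic {V : Type*} {G : SimpleGraph V} {𝔉 : Set (Set V)}
    {W : SimpleGraph (MaxClique G Set.univ)} (h : HierarchyCondition G 𝔉 W) :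
    IsIntrinsic G 𝔉 W := by
  obtain ⟨WF, hWF⟩ := h
  exact fun H hH ↦ ⟨WF H, (hWF H hH H hH le_rfl).1⟩

/-- The link of `F` and the projection vertices of the domains in it. -/
def linkPart {V : Type*} (G : SimpleGraph V) (𝔉 : Set (Set V)) (F : Set V) : Set (V ⊕ Set V) :=
  {a | (∃ v ∈ link G F, a = .inl v) ∨ ∃ H ∈ 𝔉, H ⊆ link G F ∧ a = .inr H}

/-- The vertices of the augmented graph of `H` outside the link part of `F`. -/
def core {V : Type*} (G : SimpleGraph V) (𝔉 : Set (Set V)) (F H : Set V) : Set (V ⊕ Set V) :=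
  augVerts 𝔉 H \ linkPart G 𝔉 F

section membership

variable {V : Type*} {G : SimpleGraph V} {𝔉 : Set (Set V)} {F H K : Set V} {v : V}

theorem inl_mem_linkPart : .inl v ∈ linkPart G 𝔉 F ↔ v ∈ link G F := by
  simp [linkPart]

theorem inr_mem_linkPart : .inr K ∈ linkPart G 𝔉 F ↔ K ∈ 𝔉 ∧ K ⊆ link G F := by
  simp [linkPart]

theorem inl_mem_augVerts : .inl v ∈ augVerts 𝔉 H ↔ v ∈ H := by
  simp [augVerts]

theorem inr_mem_augVerts : .inr K ∈ augVerts 𝔉 H ↔ K ∈ 𝔉 ∧ K ⊂ H := by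
  simp [augVerts]

theorem inl_mem_core : .inl v ∈ core G 𝔉 F H ↔ v ∈ H ∧ v ∉ link G F := by
  rw [core, Set.mem_sdiff, inl_mem_augVerts, inl_mem_linkPart]

theorem inr_mem_core : .inr K ∈ core G 𝔉 F H ↔ (K ∈ 𝔉 ∧ K ⊂ H) ∧ ¬ K ⊆ link G F := by
  rw [core, Set.mem_sdiff, inr_mem_augVerts, inr_mem_linkPart]
  tauto

theorem notMem_link_of_mem (hv : v ∈ F) : v ∉ link G F :=
  fun h ↦ G.loopless.irrefl v (h v hv)

theorem not_subset_link (hF : F.Nonempty) (hFK : F ⊆ K) : ¬ K ⊆ link G F := by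
  obtain ⟨f, hf⟩ := hF
  exact fun h ↦ notMem_link_of_mem hf (h (hFK hf))

theorem subset_link_singleton (hv : v ∈ link G F) : F ⊆ link G {v} := by
  rintro f hf _ rfl
  exact (hv f hf).symm

theorem IsGraphFactorSystem.ssubset_of_mem_linkPart {n : ℕ} (h : IsGraphFactorSystem G 𝔉 n)
    (hFH : F ⊆ H) {b : V ⊕ Set V} (hb : b ∈ augVerts 𝔉 H) (hbF : b ∈ linkPart G 𝔉 F) : F ⊂ H := by
  refine hFH.ssubset_of_ne ?_
  rintro rfl
  rcases b with u | J
  · exact notMem_link_of_mem (inl_mem_augVerts.1 hb) (inl_mem_linkPart.1 hbF)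
  · obtain ⟨hJ, hJF⟩ := inr_mem_linkPart.1 hbF
    obtain ⟨v, hv⟩ := h.nonempty_of_mem J hJ
    exact notMem_link_of_mem ((inr_mem_augVerts.1 hb).2.1 hv) (hJF hv)

end membership

section core

variable {V : Type*} {G : SimpleGraph V} {𝔉 : Set (Set V)} {n : ℕ} {F H K : Set V} {u s w : V}
  {W : SimpleGraph (MaxClique G Set.univ)} {δ : ℝ}

theorem HyperbolicityCondition.hyperbolicOn {h : IsGraphFactorSystem G 𝔉 n}
    (hyp : HyperbolicityCondition h W δ) (hH : H ∈ 𝔉) :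
    HyperbolicOn (edgeGraph G Set.univ W) (augVerts 𝔉 H) ⌈δ⌉₊ :=
  (hyp H hH).1.hyperbolicOn

theorem edgeGraph_adj_iff_of_augGraph_eq {W' : SimpleGraph (MaxClique G H)}
    (hW' : augGraph G 𝔉 H W' H = augGraph G 𝔉 Set.univ W H) (hs : s ∈ H) (hw : w ∈ H) :
    (edgeGraph G H W').Adj (.inl s) (.inl w) ↔
      (edgeGraph G Set.univ W).Adj (.inl s) (.inl w) := by
  have h := congrArg (fun E : SimpleGraph (augVerts 𝔉 H) ↦
    E.Adj ⟨.inl s, inl_mem_augVerts.2 hs⟩ ⟨.inl w, inl_mem_augVerts.2 hw⟩) hW'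
  exact h.to_iff

theorem MaxClique.exists_notMem_link (hF : F.Nonempty) (hFH : F ⊆ H) (x : MaxClique G H) :
    ∃ s ∈ x.1, s ∉ link G F := by
  by_contra! hx
  obtain ⟨f, hf⟩ := hF
  have hins : insert f x.1 ⊆ H ∧ G.IsClique (insert f x.1) :=
    ⟨Set.insert_subset (hFH hf) x.2.1.1, x.2.1.2.insert fun v hv _ ↦ hx v hv f hf⟩
  exact notMem_link_of_mem hf
    (hx f (x.2.2 hins (Set.subset_insert _ _) (Set.mem_insert _ _)))

theorem IsIntrinsic.exists_adj_of_adj_link (hW : IsIntrinsic G 𝔉 W) (hF : F.Nonempty) (hH : H ∈ 𝔉)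
    (hFH : F ⊆ H) (hu : u ∈ H) (huF : u ∈ link G F) (hw : w ∈ H) (hwF : w ∉ link G F)
    (huw : (edgeGraph G Set.univ W).Adj (.inl u) (.inl w)) :
    ∃ s ∈ H, s ∉ link G F ∧ G.Adj u s ∧
      Near (restr (edgeGraph G Set.univ W) (core G 𝔉 F H)) 1 (.inl s) (.inl w) := by
  obtain ⟨W', hW'⟩ := hW H hH
  obtain ⟨-, hadj | ⟨x, y, hxy, hux, hwy⟩⟩ :=
    (edgeGraph_adj_iff_of_augGraph_eq hW' hu hw).2 huw
  · exact ⟨w, hw, hwF, hadj, .refl _ _ _⟩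
  · obtain ⟨s, hsx, hsF⟩ := x.exists_notMem_link hF hFH
    have hs : s ∈ H := x.2.1.1 hsx
    refine ⟨s, hs, hsF, x.2.1.2 hux hsx (fun e ↦ hsF (e ▸ huF)), ?_⟩
    rcases eq_or_ne s w with rfl | hsw
    · exact .refl _ _ _
    · exact .of_adj ⟨inl_mem_core.2 ⟨hs, hsF⟩, inl_mem_core.2 ⟨hw, hwF⟩,
        (edgeGraph_adj_iff_of_augGraph_eq hW' hs hw).1 ⟨hsw, .inr ⟨x, y, hxy, hsx, hwy⟩⟩⟩

/-- The cone point of `link G {u} ∩ H ⊇ F` is adjacent to `s` and to all vertices of `F`. -/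
theorem IsGraphFactorSystem.near_inr_of_adj (h : IsGraphFactorSystem G 𝔉 n) (hF : F ∈ 𝔉)
    (hH : H ∈ 𝔉) (hFH : F ⊂ H) (hu : u ∈ H) (huF : u ∈ link G F) (hs : s ∈ H)
    (hsF : s ∉ link G F) (hus : G.Adj u s) :
    Near (restr (edgeGraph G Set.univ W) (core G 𝔉 F H)) 3 (.inl s) (.inr F) := by
  have hne := h.nonempty_of_mem F hF
  obtain ⟨f, hf⟩ := id hne
  have hFu := subset_link_singleton huF
  have hsu : s ∈ link G {u} := by
    rintro _ rfl
    exact hus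
  have hK : link G {u} ∩ H ∈ 𝔉 := h.inter_mem _ (h.link_mem u ⟨f, hFu hf⟩) H hH
    ⟨f, hFu hf, hFH.1 hf⟩
  have hKH : link G {u} ∩ H ⊂ H :=
    ⟨Set.inter_subset_right, fun hsub ↦ notMem_link_of_mem (Set.mem_singleton u) (hsub hu).1⟩
  have hKc : .inr (link G {u} ∩ H) ∈ core G 𝔉 F H :=
    inr_mem_core.2 ⟨⟨hK, hKH⟩, not_subset_link hne (Set.subset_inter hFu hFH.1)⟩
  have hsc : .inl s ∈ core G 𝔉 F H := inl_mem_core.2 ⟨hs, hsF⟩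
  have hfc : .inl f ∈ core G 𝔉 F H := inl_mem_core.2 ⟨hFH.1 hf, notMem_link_of_mem hf⟩
  have hFc : .inr F ∈ core G 𝔉 F H := inr_mem_core.2 ⟨⟨hF, hFH⟩, not_subset_link hne le_rfl⟩
  have hsK : (restr (edgeGraph G Set.univ W) (core G 𝔉 F H)).Adj (.inl s)
      (.inr (link G {u} ∩ H)) := ⟨hsc, hKc, hsu, hs⟩
  have hKf : (restr (edgeGraph G Set.univ W) (core G 𝔉 F H)).Adj
      (.inr (link G {u} ∩ H)) (.inl f) := ⟨hKc, hfc, hFu hf, hFH.1 hf⟩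
  have hfF : (restr (edgeGraph G Set.univ W) (core G 𝔉 F H)).Adj (.inl f) (.inr F) :=
    ⟨hfc, hFc, hf⟩
  exact ((Near.of_adj hsK).trans (.of_adj hKf)).trans (.of_adj hfF)

theorem IsIntrinsic.near_inr_of_adj_link (hW : IsIntrinsic G 𝔉 W) (h : IsGraphFactorSystem G 𝔉 n)
    (hF : F ∈ 𝔉) (hH : H ∈ 𝔉) (hFH : F ⊂ H) (hu : u ∈ H) (huF : u ∈ link G F) (hw : w ∈ H)
    (hwF : w ∉ link G F) (huw : (edgeGraph G Set.univ W).Adj (.inl u) (.inl w)) :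
    Near (restr (edgeGraph G Set.univ W) (core G 𝔉 F H)) 4 (.inl w) (.inr F) := by
  obtain ⟨s, hs, hsF, hus, hsw⟩ :=
    hW.exists_adj_of_adj_link (h.nonempty_of_mem F hF) hH hFH.1 hu huF hw hwF huw
  exact hsw.symm.trans (h.near_inr_of_adj hF hH hFH hu huF hs hsF hus)

/-- A path in `CK` from `link G F` to its complement leaves the link part of `F` along an edge of
`X`, or through the cone point of a smaller domain, to which induction applies. -/
theorem IsIntrinsic.exists_near_inr_of_not_subset_link (hW : IsIntrinsic G 𝔉 W)
    {h : IsGraphFactorSystem G 𝔉 n} (hyp : HyperbolicityCondition h W δ) (hF : F ∈ 𝔉)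
    (hH : H ∈ 𝔉) (hFH : F ⊂ H) (hK : K ∈ 𝔉) (hKH : K ⊆ H) (hu : u ∈ K) (huF : u ∈ link G F)
    (hKF : ¬ K ⊆ link G F) :
    ∃ w ∈ K, w ∉ link G F ∧
      Near (restr (edgeGraph G Set.univ W) (core G 𝔉 F H)) 4 (.inl w) (.inr F) := by
  obtain ⟨r, -, hr⟩ := h.exists_rank
  induction hm : r K using Nat.strong_induction_on generalizing K u with
  | _ m ih =>
    obtain ⟨w, hw, hwF⟩ := Set.not_subset.1 hKF
    obtain ⟨p⟩ := (hyp.hyperbolicOn hK).reachable (x := .inl u) (y := .inl w)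
      (inl_mem_augVerts.2 hu) (inl_mem_augVerts.2 hw)
    obtain ⟨a, -, b, -, ⟨haK, hbK, hab⟩, haF, hbF⟩ := exists_adj_of_walk p
      (linkPart G 𝔉 F) (inl_mem_linkPart.2 huF) (mt inl_mem_linkPart.1 hwF)
    rcases a with a | J <;> rcases b with b | J'
    · rw [inl_mem_linkPart] at haF hbF
      rw [inl_mem_augVerts] at haK hbK
      exact ⟨b, hbK, hbF, hW.near_inr_of_adj_link h hF hH hFH (hKH haK) haF (hKH hbK) hbF hab⟩
    · rw [inl_mem_linkPart] at haF
      rw [inr_mem_augVerts] at hbK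
      rw [inr_mem_linkPart] at hbF
      obtain ⟨w, hw, hwF, hn⟩ := ih (r J') (hm ▸ hr hbK.1 hK hbK.2) hbK.1
        (hbK.2.1.trans hKH) hab haF (fun hsub ↦ hbF ⟨hbK.1, hsub⟩) rfl
      exact ⟨w, hbK.2.1 hw, hwF, hn⟩
    · rw [inl_mem_linkPart] at hbF
      exact absurd ((inr_mem_linkPart.1 haF).2 hab) hbF
    · exact hab.elim

theorem IsIntrinsic.near_inr_of_adj_linkPart (hW : IsIntrinsic G 𝔉 W)
    {h : IsGraphFactorSystem G 𝔉 n} (hyp : HyperbolicityCondition h W δ) (hF : F ∈ 𝔉)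
    (hH : H ∈ 𝔉) (hFH : F ⊂ H) {a b : V ⊕ Set V} (ha : a ∈ core G 𝔉 F H)
    (hb : b ∈ augVerts 𝔉 H) (hbF : b ∈ linkPart G 𝔉 F)
    (hab : (edgeGraph G Set.univ W).Adj a b) :
    Near (restr (edgeGraph G Set.univ W) (core G 𝔉 F H)) 5 a (.inr F) := by
  rcases a with w | K <;> rcases b with u | J
  · rw [inl_mem_core] at ha
    exact (hW.near_inr_of_adj_link h hF hH hFH (inl_mem_augVerts.1 hb) (inl_mem_linkPart.1 hbF)
      ha.1 ha.2 hab.symm).mono (by omega)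
  · exact absurd ((inr_mem_linkPart.1 hbF).2 hab) (inl_mem_core.1 ha).2
  · obtain ⟨⟨hK, hKH⟩, hKF⟩ := inr_mem_core.1 ha
    obtain ⟨w, hw, hwF, hn⟩ := hW.exists_near_inr_of_not_subset_link hyp hF hH hFH hK hKH.1 hab
      (inl_mem_linkPart.1 hbF) hKF
    have hKw : (restr (edgeGraph G Set.univ W) (core G 𝔉 F H)).Adj (.inr K) (.inl w) :=
      ⟨ha, inl_mem_core.2 ⟨hKH.1 hw, hwF⟩, hw⟩
    exact (Near.of_adj hKw).trans hn
  · exact hab.elim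

/-- Excursions of a path into the link part of `F` are replaced by detours through the cone point
of `F`. -/
theorem IsIntrinsic.near_core_of_walk (hW : IsIntrinsic G 𝔉 W) {h : IsGraphFactorSystem G 𝔉 n}
    (hyp : HyperbolicityCondition h W δ) (hF : F ∈ 𝔉) (hH : H ∈ 𝔉) (hFH : F ⊆ H)
    {a b : V ⊕ Set V} (p : (restr (edgeGraph G Set.univ W) (augVerts 𝔉 H)).Walk a b)
    (hb : b ∈ core G 𝔉 F H) :
    (a ∈ core G 𝔉 F H →
      Near (restr (edgeGraph G Set.univ W) (core G 𝔉 F H)) (5 * p.length) a b) ∧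
    (a ∈ augVerts 𝔉 H → a ∈ linkPart G 𝔉 F →
      Near (restr (edgeGraph G Set.univ W) (core G 𝔉 F H)) (5 * p.length) (.inr F) b) := by
  induction p with
  | nil => exact ⟨fun _ ↦ .refl _ _ _, fun _ ha ↦ absurd ha hb.2⟩
  | @cons a v b hav p ih =>
    obtain ⟨ihc, ihl⟩ := ih hb
    have hv : v ∈ augVerts 𝔉 H := hav.2.1
    rw [Walk.length_cons]
    by_cases hvF : v ∈ linkPart G 𝔉 F
    · have hFb := ihl hv hvF
      refine ⟨fun ha ↦ ?_, fun _ _ ↦ hFb.mono (by omega)⟩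
      have hFH' := h.ssubset_of_mem_linkPart hFH hv hvF
      exact ((hW.near_inr_of_adj_linkPart hyp hF hH hFH' ha hv hvF hav.2.2).trans hFb).mono
        (by omega)
    · have hvb := ihc ⟨hv, hvF⟩
      refine ⟨fun ha ↦ ?_, fun ha haF ↦ ?_⟩
      · have hav' : (restr (edgeGraph G Set.univ W) (core G 𝔉 F H)).Adj a v :=
          ⟨ha, ⟨hv, hvF⟩, hav.2.2⟩
        exact ((Near.of_adj hav').trans hvb).mono (by omega)
      · have hFH' := h.ssubset_of_mem_linkPart hFH ha haF
        have hvF' := hW.near_inr_of_adj_linkPart hyp hF hH hFH' ⟨hv, hvF⟩ ha haF hav.2.2.symm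
        exact (hvF'.symm.trans hvb).mono (by omega)

theorem IsIntrinsic.near_core (hW : IsIntrinsic G 𝔉 W) {h : IsGraphFactorSystem G 𝔉 n}
    (hyp : HyperbolicityCondition h W δ) (hF : F ∈ 𝔉) (hH : H ∈ 𝔉) (hFH : F ⊆ H)
    {a b : V ⊕ Set V} (ha : a ∈ core G 𝔉 F H) (hb : b ∈ core G 𝔉 F H) {m : ℕ}
    (hab : Near (restr (edgeGraph G Set.univ W) (augVerts 𝔉 H)) m a b) :
    Near (restr (edgeGraph G Set.univ W) (core G 𝔉 F H)) (5 * m) a b := by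
  obtain ⟨p, hp⟩ := hab.exists_walk
  exact ((hW.near_core_of_walk hyp hF hH hFH p hb).1 ha).mono (Nat.mul_le_mul_left 5 hp)

theorem IsGraphFactorSystem.exists_near_core (h : IsGraphFactorSystem G 𝔉 n) (hF : F.Nonempty)
    (hFH : F ⊆ H) {a : V ⊕ Set V} (ha : a ∈ augVerts 𝔉 H) :
    ∃ b ∈ core G 𝔉 F H, Near (restr (edgeGraph G Set.univ W) (augVerts 𝔉 H)) 2 a b := by
  obtain ⟨f, hf⟩ := hF
  have hfF := notMem_link_of_mem (G := G) hf
  have hadj (u : V) (hu : u ∈ H) (huF : u ∈ link G F) :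
      (restr (edgeGraph G Set.univ W) (augVerts 𝔉 H)).Adj (.inl u) (.inl f) :=
    ⟨inl_mem_augVerts.2 hu, inl_mem_augVerts.2 (hFH hf),
      fun e ↦ hfF (e ▸ huF), .inl (huF f hf).symm⟩
  by_cases haF : a ∈ linkPart G 𝔉 F
  · refine ⟨.inl f, inl_mem_core.2 ⟨hFH hf, hfF⟩, ?_⟩
    rcases a with u | J
    · exact (Near.of_adj
        (hadj u (inl_mem_augVerts.1 ha) (inl_mem_linkPart.1 haF))).mono (by omega)
    · obtain ⟨hJ, hJF⟩ := inr_mem_linkPart.1 haF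
      obtain ⟨-, hJH⟩ := inr_mem_augVerts.1 ha
      obtain ⟨j, hj⟩ := h.nonempty_of_mem J hJ
      have hJj : (restr (edgeGraph G Set.univ W) (augVerts 𝔉 H)).Adj (.inr J) (.inl j) :=
        ⟨ha, inl_mem_augVerts.2 (hJH.1 hj), hj⟩
      exact (Near.of_adj hJj).trans (.of_adj (hadj j (hJH.1 hj) (hJF hj)))
  · exact ⟨a, ⟨ha, haF⟩, .refl _ _ _⟩

/-- The hyperbolicity constant of the augmented graphs without the link part. -/
def coreConst (δ : ℕ) : ℕ := 64 * (5 * (2 * 5 + δ + 1) + 1) ^ 2 + 2 * (5 * (2 * 5 + δ + 1))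

theorem IsIntrinsic.hyperbolicOn_core (hW : IsIntrinsic G 𝔉 W) {h : IsGraphFactorSystem G 𝔉 n}
    (hyp : HyperbolicityCondition h W δ) (hF : F ∈ 𝔉) (hH : H ∈ 𝔉) (hFH : F ⊆ H) :
    HyperbolicOn (edgeGraph G Set.univ W) (core G 𝔉 F H) (coreConst ⌈δ⌉₊) := by
  refine (hyp.hyperbolicOn hH).of_dense Set.sdiff_subset (fun a ha ↦ ?_)
    fun m a ha b hb ↦ hW.near_core hyp hF hH hFH ha hb
  obtain ⟨b, hb, hab⟩ := h.exists_near_core (h.nonempty_of_mem F hF) hFH ha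
  exact ⟨b, hb, hab.mono (by omega)⟩

end core

/-! ### Adding cone points by rank -/

/-- The vertices of `CX` outside the link part of `F`, without the projection vertices of the
domains containing `F` of rank at least `k`. This interpolates between the complement graph of `F`
and `core G 𝔉 F Set.univ`. -/
def level {V : Type*} (G : SimpleGraph V) (𝔉 : Set (Set V)) (F : Set V) (r : Set V → ℕ) (k : ℕ) :
    Set (V ⊕ Set V) :=
  {a ∈ core G 𝔉 F Set.univ | ∀ H, a = .inr H → F ⊆ H → r H < k}

/-- The projection vertices of the non-maximal domains containing `F` of rank `k`. -/
def levelCones {V : Type*} (𝔉 : Set (Set V)) (F : Set V) (r : Set V → ℕ) (k : ℕ) :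
    Set (V ⊕ Set V) :=
  Sum.inr '' {H ∈ 𝔉 | F ⊆ H ∧ H ≠ Set.univ ∧ r H = k}

section level

variable {V : Type*} {G : SimpleGraph V} {𝔉 : Set (Set V)} {F H K : Set V} {v : V} {r : Set V → ℕ}
  {k n : ℕ} {a : V ⊕ Set V}

theorem mem_complVerts :
    a ∈ complVerts G 𝔉 F ↔ a ∈ core G 𝔉 F Set.univ ∧ ∀ H, a = .inr H → ¬ F ⊆ H := by
  rcases a with v | K
  · simp [complVerts, core, projPart, linkPart]
  · simp only [complVerts, core, projPart, linkPart, Set.mem_sdiff, inr_mem_augVerts,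
      Set.ssubset_univ_iff, Set.mem_ofPred_eq, reduceCtorEq, and_false, exists_false, false_or,
      Sum.inr.injEq, forall_eq', ← and_assoc, exists_eq_right']
    tauto

theorem inr_mem_core_univ (hF : F.Nonempty) (hFK : F ⊆ K) :
    .inr K ∈ core G 𝔉 F Set.univ ↔ K ∈ 𝔉 ∧ K ≠ Set.univ := by
  rw [inr_mem_core, Set.ssubset_univ_iff, and_iff_left (not_subset_link hF hFK)]

theorem inl_mem_level : .inl v ∈ level G 𝔉 F r k ↔ v ∉ link G F := by
  simp [level, inl_mem_core]

theorem inr_mem_level :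
    .inr K ∈ level G 𝔉 F r k ↔ .inr K ∈ core G 𝔉 F Set.univ ∧ (F ⊆ K → r K < k) := by
  simp [level]

theorem level_subset_augVerts : level G 𝔉 F r k ⊆ augVerts 𝔉 Set.univ :=
  fun _ ha ↦ ha.1.1

theorem complVerts_subset_level : complVerts G 𝔉 F ⊆ level G 𝔉 F r k := fun _ ha ↦
  have h := mem_complVerts.1 ha
  ⟨h.1, fun H haH hFH ↦ absurd hFH (h.2 H haH)⟩

theorem inr_notMem_complVerts : .inr F ∉ complVerts G 𝔉 F :=
  fun h ↦ (mem_complVerts.1 h).2 F rfl le_rfl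

theorem inr_mem_level_self (hF : F.Nonempty) (hF𝔉 : F ∈ 𝔉) (hFu : F ≠ Set.univ) (hk : r F < k) :
    .inr F ∈ level G 𝔉 F r k :=
  inr_mem_level.2 ⟨(inr_mem_core_univ hF le_rfl).2 ⟨hF𝔉, hFu⟩, fun _ ↦ hk⟩

theorem level_eq_core (hr : ∀ H ∈ 𝔉, r H < n) :
    level G 𝔉 F r n = core G 𝔉 F Set.univ := by
  refine (Set.sep_subset _ _).antisymm fun a ha ↦ ⟨ha, ?_⟩
  rintro H rfl -
  exact hr H (inr_mem_core.1 ha).1.1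

theorem disjoint_level_levelCones : Disjoint (level G 𝔉 F r k) (levelCones 𝔉 F r k) := by
  rw [Set.disjoint_right]
  rintro _ ⟨H, ⟨-, hFH, -, rfl⟩, rfl⟩ hH
  exact lt_irrefl _ ((inr_mem_level.1 hH).2 hFH)

theorem level_union_levelCones (hF : F.Nonempty) :
    level G 𝔉 F r k ∪ levelCones 𝔉 F r k = level G 𝔉 F r (k + 1) := by
  ext a
  rcases a with v | K
  · simp [levelCones, inl_mem_level]
  · simp only [Set.mem_union, inr_mem_level, levelCones, Set.mem_image, Sum.inr.injEq,
      exists_eq_right, Set.mem_ofPred_eq]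
    by_cases hFK : F ⊆ K
    · simp only [inr_mem_core_univ hF hFK, hFK, forall_const, true_and, Order.lt_add_one_iff,
        le_iff_lt_or_eq]
      tauto
    · simp [hFK]

theorem core_subset_core (hFH : F ⊆ H) : core G 𝔉 F K ⊆ core G 𝔉 H K := by
  have hlink : link G H ⊆ link G F := fun v hv u hu ↦ hv u (hFH hu)
  refine Set.sdiff_subset_sdiff_right ?_
  rintro a (⟨v, hv, rfl⟩ | ⟨J, hJ, hJH, rfl⟩)
  · exact inl_mem_linkPart.2 (hlink hv)
  · exact inr_mem_linkPart.2 ⟨hJ, hJH.trans hlink⟩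

theorem level_succ_sdiff_subset (hH : H ∈ 𝔉) (hFH : F ⊆ H) (hr : StrictMonoOn r 𝔉) :
    level G 𝔉 F r (r H + 1) \ {.inr H} ⊆ complVerts G 𝔉 H := by
  rintro a ⟨ha, hne⟩
  refine mem_complVerts.2 ⟨core_subset_core hFH ha.1, ?_⟩
  rintro K rfl hHK
  have hlt := ha.2 K rfl (hFH.trans hHK)
  have := hr hH (inr_mem_core.1 ha.1).1.1 (hHK.ssubset_of_ne fun e ↦ hne (congrArg _ e.symm))
  omega

theorem core_subset_level (hH : H ∈ 𝔉) (hr : StrictMonoOn r 𝔉) :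
    core G 𝔉 F H ⊆ level G 𝔉 F r (r H) := by
  rintro (v | K) ha
  · exact inl_mem_level.2 (inl_mem_core.1 ha).2
  · obtain ⟨⟨hK, hKH⟩, hKF⟩ := inr_mem_core.1 ha
    exact inr_mem_level.2 ⟨inr_mem_core.2 ⟨⟨hK, hKH.trans_subset (Set.subset_univ H)⟩, hKF⟩,
      fun _ ↦ hr hK hH hKH⟩

end level

theorem IsQIEmbedding.dist_le {A B : Type*} {E : SimpleGraph A} {E' : SimpleGraph B} {δ : ℝ}
    {f : A → B} (h : IsQIEmbedding E E' δ f) (hδ : 0 < δ) {a b : A} {m : ℕ}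
    (hab : Near E' m (f a) (f b)) : (E.dist a b : ℝ) ≤ δ * (m + δ) := by
  have hlower := (h a b).2.1
  have hdist : (E'.dist (f a) (f b) : ℝ) ≤ m :=
    Nat.cast_le.2 (near_iff_reachable_and_dist_le.1 hab).2
  rw [← div_le_iff₀' hδ]
  linarith

/-- The distortion constant of the cores of the domains. -/
def distortionConst (δ : ℕ) : ℕ := 5 * (δ * (1 + δ))

/-- The subgraph over which the cone point of a domain is a cone; the value at the vertices of `X`
is immaterial. -/
def coneCore {V : Type*} (G : SimpleGraph V) (𝔉 : Set (Set V)) (F : Set V) :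
    V ⊕ Set V → Set (V ⊕ Set V)
  | .inl _ => ∅
  | .inr H => core G 𝔉 F H

/-- The hyperbolicity constant of the graph obtained by removing `j` levels of cone points. -/
def levelConst (δ : ℕ) : ℕ → ℕ
  | 0 => coreConst δ
  | j + 1 => levelConst δ j +
      (64 * (guessConst (levelConst δ j) (distortionConst δ) + 1) ^ 2 +
        2 * guessConst (levelConst δ j) (distortionConst δ))

theorem levelConst_mono (δ : ℕ) : Monotone (levelConst δ) :=
  monotone_nat_of_le_succ fun _ ↦ Nat.le_add_right _ _

section hyperbolicity

variable {V : Type*} {G : SimpleGraph V} {𝔉 : Set (Set V)} {n : ℕ} {F H : Set V}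
  {W : SimpleGraph (MaxClique G Set.univ)} {δ : ℝ} {r : Set V → ℕ}

theorem HyperbolicityCondition.near_augVerts {h : IsGraphFactorSystem G 𝔉 n}
    (hyp : HyperbolicityCondition h W δ) (hδ : 0 < δ) (hH : H ∈ 𝔉) {a b : V ⊕ Set V}
    (ha : a ∈ augVerts 𝔉 H) (hb : b ∈ augVerts 𝔉 H) {m : ℕ}
    (hab : Near (restr (edgeGraph G Set.univ W) (complVerts G 𝔉 H)) m a b) :
    Near (restr (edgeGraph G Set.univ W) (augVerts 𝔉 H)) (⌈δ⌉₊ * (1 + ⌈δ⌉₊) * (m + 1)) a b := by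
  lift a to augVerts 𝔉 H using ha
  lift b to augVerts 𝔉 H using hb
  have hsub := augVerts_subset_complVerts h H
  have hdist := (hyp H hH).2.dist_le hδ
    (near_restr_iff (x := Set.inclusion hsub a) (y := Set.inclusion hsub b).1 hab)
  have hceil : δ * (m + δ) ≤ (⌈δ⌉₊ * (m + ⌈δ⌉₊) : ℕ) := by
    push_cast
    gcongr <;> exact Nat.le_ceil δ
  refine near_restr_iff.2 (near_iff_reachable_and_dist_le.2
    ⟨(hyp H hH).1.1.preconnected a b, (Nat.cast_le.1 (hdist.trans hceil)).trans ?_⟩)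
  rw [mul_assoc]
  gcongr
  nlinarith

theorem IsIntrinsic.coneSystem (hW : IsIntrinsic G 𝔉 W) {h : IsGraphFactorSystem G 𝔉 n}
    (hyp : HyperbolicityCondition h W δ) (hδ : 0 < δ) (hF : F ∈ 𝔉) (hr : StrictMonoOn r 𝔉)
    {k D : ℕ} (hD : coreConst ⌈δ⌉₊ ≤ D)
    (hlevel : HyperbolicOn (edgeGraph G Set.univ W) (level G 𝔉 F r (k + 1)) D) :
    ConeSystem (edgeGraph G Set.univ W) (level G 𝔉 F r k) (levelCones 𝔉 F r k) (coneCore G 𝔉 F)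
      D (distortionConst ⌈δ⌉₊) where
  disjoint := disjoint_level_levelCones
  hyperbolicOn := by rwa [level_union_levelCones (h.nonempty_of_mem F hF)]
  cone_subset := by
    rintro _ ⟨H, ⟨hH, -, -, rfl⟩, rfl⟩
    exact core_subset_level hH hr
  mem_cone := by
    rintro _ ⟨H, -, rfl⟩ (v | K) hv hadj
    · rw [level_union_levelCones (h.nonempty_of_mem F hF), inl_mem_level] at hv
      exact inl_mem_core.2 ⟨hadj, hv⟩
    · exact hadj.elim
  hyperbolicOn_cone := by
    rintro _ ⟨H, ⟨hH, hFH, -, -⟩, rfl⟩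
    exact (hW.hyperbolicOn_core hyp hF hH hFH).mono hD
  undistorted := by
    rintro _ ⟨H, ⟨hH, hFH, -, rfl⟩, rfl⟩ a ha b hb m hab
    rw [level_union_levelCones (h.nonempty_of_mem F hF)] at hab
    have hab' := hyp.near_augVerts hδ hH ha.1 hb.1
      (hab.mono_graph (restr_mono (level_succ_sdiff_subset hH hFH hr)))
    rw [distortionConst, mul_assoc]
    exact hW.near_core hyp hF hH hFH ha hb hab'

theorem IsIntrinsic.hyperbolicOn_level (hW : IsIntrinsic G 𝔉 W) {h : IsGraphFactorSystem G 𝔉 n}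
    (hyp : HyperbolicityCondition h W δ) (hδ : 0 < δ) (hF : F ∈ 𝔉) (hr : StrictMonoOn r 𝔉)
    (hrn : ∀ H ∈ 𝔉, r H < n) {j k : ℕ} (hjk : k + j = n) :
    HyperbolicOn (edgeGraph G Set.univ W) (level G 𝔉 F r k) (levelConst ⌈δ⌉₊ j) := by
  induction j generalizing k with
  | zero =>
    obtain rfl : k = n := hjk
    rw [level_eq_core hrn]
    exact hW.hyperbolicOn_core hyp hF h.univ_mem (Set.subset_univ F)
  | succ j ih =>
    exact (hW.coneSystem hyp hδ hF hr (levelConst_mono _ (Nat.zero_le j))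
      (ih (by omega))).hyperbolicOn_base.mono (Nat.le_add_left _ _)

end hyperbolicity

/-! ### Closest-point projections -/

section closestProj

variable {V : Type*} {G : SimpleGraph V} {𝔉 : Set (Set V)} {n D : ℕ} {F : Set V}
  {W : SimpleGraph (MaxClique G Set.univ)} {r : Set V → ℕ} {h : IsGraphFactorSystem G 𝔉 n}
  {x y : complVerts G 𝔉 F} {a b : augVerts 𝔉 F}

theorem near_of_mem_closestProj (ha : a ∈ closestProj h W F x) {z : V ⊕ Set V}
    (hz : z ∈ augVerts 𝔉 F) {m : ℕ}
    (hxz : Near (restr (edgeGraph G Set.univ W) (complVerts G 𝔉 F)) m x z) :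
    Near (restr (edgeGraph G Set.univ W) (complVerts G 𝔉 F)) (m + 1) x a := by
  lift z to augVerts 𝔉 F using hz
  have hsub := augVerts_subset_complVerts h F
  have hxz' : Near (complGraph G 𝔉 W F) m x (Set.inclusion hsub z) := near_restr_iff.1 hxz
  have hxa : Near (complGraph G 𝔉 W F) (m + 1) x (Set.inclusion hsub a) := by
    refine le_trans ha ?_
    rw [Nat.cast_succ]
    gcongr
    exact (iInf_le _ z).trans hxz'
  exact near_restr_iff.2 hxa

theorem IsGraphFactorSystem.near_inr_of_mem_augVerts (h : IsGraphFactorSystem G 𝔉 n) (hF : F ∈ 𝔉)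
    (hFu : F ≠ Set.univ) {k : ℕ} (hk : r F < k) {a : V ⊕ Set V} (ha : a ∈ augVerts 𝔉 F) :
    Near (restr (edgeGraph G Set.univ W) (level G 𝔉 F r k)) 2 a (.inr F) := by
  have hFl : .inr F ∈ level G 𝔉 F r k := inr_mem_level_self (h.nonempty_of_mem F hF) hF hFu hk
  have hadj {v : V} (hv : v ∈ F) :
      (restr (edgeGraph G Set.univ W) (level G 𝔉 F r k)).Adj (.inl v) (.inr F) :=
    ⟨inl_mem_level.2 (notMem_link_of_mem hv), hFl, hv⟩
  rcases a with v | K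
  · exact (Near.of_adj (hadj (inl_mem_augVerts.1 ha))).mono (by omega)
  · obtain ⟨hK, hKF⟩ := inr_mem_augVerts.1 ha
    obtain ⟨v, hv⟩ := h.nonempty_of_mem K hK
    have hKv : (restr (edgeGraph G Set.univ W) (level G 𝔉 F r k)).Adj (.inr K) (.inl v) :=
      ⟨complVerts_subset_level (augVerts_subset_complVerts h F ha), (hadj (hKF.1 hv)).1, hv⟩
    exact (Near.of_adj hKv).trans (.of_adj (hadj (hKF.1 hv)))

theorem restr_level_compl_le (hF : F ∈ 𝔉) (hr : StrictMonoOn r 𝔉) :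
    restr (restr (edgeGraph G Set.univ W) (level G 𝔉 F r (r F + 1))) {.inr F}ᶜ ≤
      restr (edgeGraph G Set.univ W) (complVerts G 𝔉 F) := by
  rw [restr_restr, ← Set.sdiff_eq]
  exact restr_mono (level_succ_sdiff_subset hF le_rfl hr)

theorem near_gate_of_mem_closestProj (hF : F ∈ 𝔉) (hFu : F ≠ Set.univ) (hr : StrictMonoOn r 𝔉)
    (hZ : HyperbolicOn (edgeGraph G Set.univ W) (level G 𝔉 F r (r F + 1)) D)
    (ha : a ∈ closestProj h W F x) {g : V ⊕ Set V}
    (hg : IsGate (restr (edgeGraph G Set.univ W) (level G 𝔉 F r (r F + 1))) (.inr F) x g) :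
    Near (restr (edgeGraph G Set.univ W) (complVerts G 𝔉 F)) (8 * D + 7) g a := by
  have hoff := restr_level_compl_le (G := G) (W := W) hF hr
  have haF : a.1 ≠ .inr F :=
    fun e ↦ inr_notMem_complVerts (e ▸ augVerts_subset_complVerts h F a.2)
  refine (near_gate_of_edist_le hZ.slim haF
    (h.near_inr_of_mem_augVerts hF hFu (Nat.lt_succ_self _) a.2) ?_ hg).mono_graph hoff
  obtain ⟨q, hadj, hq⟩ := hg
  have hgF : g ∈ augVerts 𝔉 F := by
    rcases g with f | K
    · exact inl_mem_augVerts.2 hadj.2.2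
    · exact hadj.2.2.elim
  have hxg := (near_off_of_notMem_support (notMem_support_of_isGeodesic_concat hq)
    le_rfl).mono_graph hoff
  have hxa := (near_of_mem_closestProj ha hgF hxg).mono_graph
    (restr_mono (complVerts_subset_level (r := r) (k := r F + 1)))
  refine hxa.trans_eq ?_
  rw [← (q.concat hadj).reachable.coe_dist_eq_edist, ← hq, Walk.length_concat]

/-- A geodesic of `CX` avoiding the projection part of `F` is a geodesic of the level containing
`b_F` that avoids `b_F`. -/
theorem exists_isGeodesic_level
    {γ : (augGraph G 𝔉 Set.univ W Set.univ).Walk (Set.inclusion (complVerts_subset G 𝔉 F) x)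
      (Set.inclusion (complVerts_subset G 𝔉 F) y)}
    (hγ : IsGeodesic γ) (hγF : ∀ v ∈ γ.support, v.1 ∉ projPart G 𝔉 F) (k : ℕ) :
    ∃ p : (restr (edgeGraph G Set.univ W) (level G 𝔉 F r k)).Walk x.1 y.1,
      IsGeodesic p ∧ .inr F ∉ p.support := by
  have hmem (v) (hv : v ∈ γ.support) : v.1 ∈ complVerts G 𝔉 F := ⟨v.2, hγF v hv⟩
  obtain ⟨p, hp, hpγ⟩ := exists_isGeodesic_restr level_subset_augVerts hγ
    fun v hv ↦ complVerts_subset_level (r := r) (k := k) (hmem v hv)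
  refine ⟨p, hp, fun hF ↦ ?_⟩
  obtain ⟨v, hv, hvF⟩ := hpγ _ hF
  exact inr_notMem_complVerts (hvF ▸ hmem v hv)

theorem near_of_mem_closestProj_of_isGeodesic (hF : F ∈ 𝔉) (hFu : F ≠ Set.univ)
    (hr : StrictMonoOn r 𝔉)
    (hZ : HyperbolicOn (edgeGraph G Set.univ W) (level G 𝔉 F r (r F + 1)) D)
    (ha : a ∈ closestProj h W F x) (hb : b ∈ closestProj h W F y)
    {γ : (augGraph G 𝔉 Set.univ W Set.univ).Walk (Set.inclusion (complVerts_subset G 𝔉 F) x)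
      (Set.inclusion (complVerts_subset G 𝔉 F) y)}
    (hγ : IsGeodesic γ) (hγF : ∀ v ∈ γ.support, v.1 ∉ projPart G 𝔉 F) :
    Near (complGraph G 𝔉 W F) (24 * D + 20) (Set.inclusion (augVerts_subset_complVerts h F) a)
      (Set.inclusion (augVerts_subset_complVerts h F) b) := by
  have hFl : .inr F ∈ level G 𝔉 F r (r F + 1) :=
    inr_mem_level_self (h.nonempty_of_mem F hF) hF hFu (Nat.lt_succ_self _)
  have hgate (z : complVerts G 𝔉 F) :
      ∃ g, IsGate (restr (edgeGraph G Set.univ W) (level G 𝔉 F r (r F + 1))) (.inr F) z g :=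
    exists_isGate (hZ.reachable (complVerts_subset_level z.2) hFl)
      fun e ↦ inr_notMem_complVerts (e ▸ z.2)
  obtain ⟨g, hg⟩ := hgate x
  obtain ⟨g', hg'⟩ := hgate y
  obtain ⟨p, hp, hpF⟩ := exists_isGeodesic_level (r := r) hγ hγF (r F + 1)
  have hag := (near_gate_of_mem_closestProj hF hFu hr hZ ha hg).symm
  have hgg' := (near_gates_of_notMem_support hZ.slim hp hpF hg hg').mono_graph
    (restr_level_compl_le hF hr)
  have hgb := near_gate_of_mem_closestProj hF hFu hr hZ hb hg'
  exact near_restr_iff.1 (((hag.trans hgg').trans hgb).mono (by omega))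

end closestProj

end CHHF

theorem lemma3p22_general (n : ℕ) (δ : ℝ) (hδ : 0 < δ) :
    ∃ C : ℝ, ∀ (V : Type*) (G : SimpleGraph V) (W : SimpleGraph (CHHF.MaxClique G Set.univ))
      (𝔉 : Set (Set V)) (h : CHHF.IsGraphFactorSystem G 𝔉 n),
      CHHF.HyperbolicityCondition h W δ → CHHF.IsIntrinsic G 𝔉 W →
      ∀ F ∈ 𝔉, F ≠ Set.univ → ∀ x y : CHHF.complVerts G 𝔉 F,
        ∀ a ∈ CHHF.closestProj h W F x, ∀ b ∈ CHHF.closestProj h W F y,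
          C ≤ ((CHHF.augGraph G 𝔉 Set.univ W F).dist a b : ℝ) →
          ∀ γ : (CHHF.augGraph G 𝔉 Set.univ W Set.univ).Walk
              (Set.inclusion (CHHF.complVerts_subset G 𝔉 F) x)
              (Set.inclusion (CHHF.complVerts_subset G 𝔉 F) y),
            CHHF.IsGeodesic γ → ∃ v ∈ γ.support, v.1 ∈ CHHF.projPart G 𝔉 F := by
  refine ⟨δ * ((24 * CHHF.levelConst ⌈δ⌉₊ n + 20 : ℕ) + δ) + 1, ?_⟩
  intro V G W 𝔉 h hyp hW F hF hFu x y a ha b hb hC γ hγ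
  by_contra! hγF
  obtain ⟨r, hrn, hr⟩ := h.exists_rank
  have hlevel := (hW.hyperbolicOn_level hyp hδ hF hr hrn
    (Nat.add_sub_cancel' (Nat.succ_le_of_lt (hrn F hF)))).mono
      (CHHF.levelConst_mono _ (Nat.sub_le n (r F + 1)))
  have hab := CHHF.near_of_mem_closestProj_of_isGeodesic hF hFu hr hlevel ha hb hγ hγF
  have hdist := (hyp F hF).2.dist_le hδ hab
  linarith

theorem lemma3p22 (n : ℕ) (δ : ℝ) (hδ : 0 < δ) :
    ∃ C : ℝ, ∀ (V : Type*) (G : SimpleGraph V) (W : SimpleGraph (CHHF.MaxClique G Set.univ))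
      (𝔉 : Set (Set V)) (h : CHHF.IsCHHF G W 𝔉 n δ) (F : Set V), F ∈ 𝔉 → F ≠ Set.univ →
      ∀ x y : CHHF.complVerts G 𝔉 F,
        ∀ a ∈ CHHF.closestProj h.factorSystem W F x,
        ∀ b ∈ CHHF.closestProj h.factorSystem W F y,
          C ≤ ((CHHF.augGraph G 𝔉 Set.univ W F).dist a b : ℝ) →
          ∀ γ : (CHHF.augGraph G 𝔉 Set.univ W Set.univ).Walk
              (Set.inclusion (CHHF.complVerts_subset G 𝔉 F) x)
              (Set.inclusion (CHHF.complVerts_subset G 𝔉 F) y),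
            CHHF.IsGeodesic γ → ∃ v ∈ γ.support, v.1 ∈ CHHF.projPart G 𝔉 F := by
  obtain ⟨C, hC⟩ := lemma3p22_general n δ hδ
  exact ⟨C, fun V G W 𝔉 h ↦ hC V G W 𝔉 h.factorSystem h.hyperbolicity h.hierarchy.isIntrinsic⟩
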